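/- **Setting.** Let $n\ge 2$, let $\pi=\{\alpha_1,\dots,\alpha_{n-1}\}$, $\alpha_i=\varepsilon_i-\varepsilon_{i+1}$, be the simple roots of $\mathfrak{sl}_n$, $\Delta=\{\varepsilon_x-\varepsilon_y : x\ne y\in[1,n]\}$ its roots, and let $\pi^+,\pi^-\subseteq\pi$ satisfy $\pi^+\cup\pi^-=\pi$ and $\pi^+\cap\pi^-\ne\pi$. Put $$R=(\mathbb N\pi^+\cup-\mathbb N\pi^-)\cap\Delta,\qquad K=\Delta\setminus R,\qquad R_*=(R\cup -R)\setminus R.$$ A root is *nil* if it lies in $K\cup -K$. Let $\mathscr J^\pm$ be the partition of $[1,n]$ into intervals such that $i,i+1$ lie in the same interval iff $\alpha_i\in\pi^\pm$. Objects with superscript $+$ (resp. $-$) are said to be above (resp. below) the line. **Markings.** For each interval $[l,r]$ of $\mathscr J^{\pm}$ and $l\le i\le j$ with $i+j=l+r-1$ there is a half-integer arc above (resp. below) joining the half-integer points $i+\frac12$ and $j+\frac12$; it is trivial if $i=j$. These arcs divide the half-integer points into connected classes (half-integer meanders). On each half-integer meander exactly one arc is marked; if the meander has a trivial arc, the marked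 arc is a trivial one. Marking the half-integer arc $(i+\frac12,j+\frac12)$ marks the integer arc $(i,j+1)$, $j+1=\kappa(i)$, where $\kappa(x)=l+r-x$ on $[l,r]$. **Modified involutions.** Let $[l,r]$ be an interval of $\mathscr J^\pm$ with $m=r-l+1$ points, and let $[u,v]$ be a maximal interval of left ends of marked integer arcs of $[l,r]$. Put $v'=v$ if $2v+1=l+r$ and $v'=v+1$ otherwise, and $X=[u,v']\cup\kappa([u,v'])$. An anti-Toeplitz involution of $X$ is an involution $\sigma$ of $X$ such that (i) $X$ is a single $\langle\kappa,\sigma\rangle$-orbit, which is also a $\langle\kappa\sigma\rangle$-orbit if $v-l+1=\lfloor m/2\rfloor$, and is not a $\langle\kappa\sigma\rangle$-orbit otherwise; (ii) if $\sigma(x)\ne x$, then one of $x,\sigma(x)$ lies in $[u,v']$ and the other in $\kappa([u,v'])$. Let $\sigma^\pm$ be an involution of $[1,n]$ that is an anti-Toeplitz involution on each such $X$ and equals $\kappa$ on the remaining points of each interval of $\mathscr J^\pm$. The directed arcs are $S=\{(x,y):x<y=\sigma^+(x)\}\cup\{(x,y):x>y=\sigma^-(x)\}$; an arc $(x,y)$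 points from $x$ to $y$ and represents $\varepsilon_x-\varepsilon_y$. **Edges.** A non-trivial edge $E$ is a $\langle\sigma^+,\sigma^-\rangle$-orbit with $e=|E|>1$ that is also a $\langle\sigma^+\sigma^-\rangle$-orbit. Choose one of its two end-points (the points of $E$ fixed by $\sigma^+$ or $\sigma^-$) as starting point $a$, and let $\varphi(1)=a,\varphi(2),\dots,\varphi(e)$ be the enumeration of $E$ obtained from $a$ by applying $\sigma^+$ and $\sigma^-$ alternately, first the one not fixing $a$. Put $\beta_i=\varepsilon_{\varphi(i)}-\varepsilon_{\varphi(i+1)}$, and let the $i$-th short arc be the directed arc of $S$ joining $\varphi(i)$ and $\varphi(i+1)$, $1\le i<e$. The turning points are $\varphi(1)$, $\varphi(e)$, and the internal turning points $\varphi(t)$, $1<t<e$, at which $\varphi(t)-\varphi(t-1)$ and $\varphi(t)-\varphi(t+1)$ have opposite signs. A turning point is a source (resp. sink) if all arcs of $S$ meeting it depart from it (resp. arrive at it). **Straightening.** Choose a signature $sg(t)\in\{1,-1\}$ for each internal turning point $\varphi(t)$ with: $sg(t)=1$ if $\beta_t$ is nil; $sg(t)=-1$ if $\beta_{t-1}$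 is nil and $\beta_t$ is not; $sg(t)$ arbitrary if neither is nil. If $sg(t)=1$ (resp. $-1$), the short arc of index $t-1$ (resp. $t$) is deleted; let $z_t=\varphi(t-1)$ (resp. $\varphi(t+1)$) be its end other than $\varphi(t)$. It is replaced by an external arc joining $z_t$ and $\varphi(s)$, directed from $\varphi(s)$ to $z_t$ if $\varphi(t)$ is a source and from $z_t$ to $\varphi(s)$ if $\varphi(t)$ is a sink. Here $\varphi(s)$ is the following turning point of type (source or sink) opposite to that of $\varphi(t)$: if $sg(t)=1$, the first one with $s>t$; if $sg(t)=-1$, the first one with $s>r$, where $\varphi(r)$ is the last internal turning point with $r<t$, of the same type as $\varphi(t)$ and with $sg(r)=-1$, and, if there is no such $r$, the first one of all. The remaining short arcs and the external arcs form the straightened edge $E^*$. **Corollary 8.4.** For every choice made above, and every non-trivial edge $E$, the directed arcs of $E^*$ form a single edge through all the points of $E$ with all arrows aligned, so that $E^*$ has a well-defined starting point $a^*$ and finishing point $b^*$; and the straightened edge value satisfies $$\iota_{E^*}=\varepsilon_{a^*}-\varepsilon_{b^*}\in -K .$$ If moreover $E=E^*$ (the two have the same directed arcs), then $\iota_{E^*}\in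 -K\cap R=-R_*$. -/

import Mathlib

open scoped Pointwise

namespace Biparabolic

/-- The two sides of the horizontal line `L`; `above` is the superscript `+`, `below` is `-`. -/
inductive Side
  | above
  | below

/-- The opposite side. -/
def Side.flip : Side → Side
  | .above => .below
  | .below => .above

/-! ### Roots of `sl_n`

The points of `L` are the integers `1, ..., n`.  Weights are written in the coordinates
`ε_1, ε_2, ...`, that is, as functions `ℤ → ℤ`.  The simple root `α_i = ε_i - ε_{i+1}` is
labelled by `i ∈ [1, n-1]`, and a set of simple roots by the set of its labels.  A pair
`P : Side → Set ℤ` stands for the pair `(π⁺, π⁻) = (P above, P below)`. -/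

/-- The vector `ε_x - ε_y`. -/
def root (x y : ℤ) : ℤ → ℤ := Pi.single x 1 - Pi.single y 1

/-- `Δ`, the set of roots of `sl_n`. -/
def Delta (n : ℕ) : Set (ℤ → ℤ) :=
  {v | ∃ x ∈ Set.Icc (1 : ℤ) n, ∃ y ∈ Set.Icc (1 : ℤ) n, x ≠ y ∧ v = root x y}

/-- The simple roots `α_i` with `i ∈ Q`. -/
def simpleRoots (Q : Set ℤ) : Set (ℤ → ℤ) := (fun i => root i (i + 1)) '' Q

/-- `R = (ℕ π⁺ ∪ -ℕ π⁻) ∩ Δ`. -/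
def R (n : ℕ) (P : Side → Set ℤ) : Set (ℤ → ℤ) :=
  ((AddSubmonoid.closure (simpleRoots (P .above)) : Set (ℤ → ℤ)) ∪
    -(AddSubmonoid.closure (simpleRoots (P .below)) : Set (ℤ → ℤ))) ∩ Delta n

/-- `K = Δ \ R`. -/
def K (n : ℕ) (P : Side → Set ℤ) : Set (ℤ → ℤ) := Delta n \ R n P

/-- `R_* = (R ∪ -R) \ R`. -/
def RStar (n : ℕ) (P : Side → Set ℤ) : Set (ℤ → ℤ) := (R n P ∪ -R n P) \ R n P

/-- A root is nil if it lies in `K ∪ -K`. -/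
def IsNil (n : ℕ) (P : Side → Set ℤ) (v : ℤ → ℤ) : Prop := v ∈ K n P ∪ -K n P

/-! ### The double partition -/

/-- `[l, r]` is a connected component (possibly a single point) of the partition of `[1, n]` into
intervals that corresponds to the set `Q ⊆ [1, n-1]` of simple roots: `i` and `i+1` are in the
same component exactly when `i ∈ Q`. -/
def IsComponent (n : ℕ) (Q : Set ℤ) (l r : ℤ) : Prop :=
  1 ≤ l ∧ l ≤ r ∧ r ≤ n ∧ (∀ i, l ≤ i → i < r → i ∈ Q) ∧ l - 1 ∉ Q ∧ r ∉ Q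

/-! ### Half-integer arcs and their markings

The simple root `α_i` is the half-integer point `i + 1/2` of `L`. -/

/-- The (non-fictitious) half-integer arc joining `i + 1/2` and `j + 1/2`, `i ≤ j`, on the side
where the set of simple roots is `Q`: `α_i` and `α_j` are exchanged by the Dynkin diagram involution
of the connected component `{α_l, ..., α_{r-1}}` of `Q`.  For `i = j` this is the trivial arc at a
fixed point of that involution. -/
def IsHalfArc (n : ℕ) (Q : Set ℤ) (i j : ℤ) : Prop :=
  ∃ l r, IsComponent n Q l r ∧ l ≤ i ∧ i ≤ j ∧ i + j = l + r - 1

/-- `α_i` and `α_j` lie on the same half-integer meander.  Fictitious arcs need not be mentioned: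
they only join points of a path of non-fictitious arcs to one another (directly or through an
additional point), or an end of such a path to itself. -/
def SameHalfMeander (n : ℕ) (P : Side → Set ℤ) : ℤ → ℤ → Prop :=
  Relation.EqvGen fun i j => ∃ s, IsHalfArc n (P s) i j

/-- `M s` is the set of the marked half-integer arcs on side `s`.  Exactly one non-fictitious arc
is marked on every half-integer meander; if the meander is an edge, that is, if it has a
non-fictitious trivial arc, then the marked arc is a trivial one. (A meander with no non-fictitious
trivial arc is a loop, possibly closed up by fictitious arcs.) -/
structure IsMarking (n : ℕ) (P : Side → Set ℤ) (M : Side → Set (ℤ × ℤ)) : Prop where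
  isHalfArc : ∀ s i j, (i, j) ∈ M s → IsHalfArc n (P s) i j
  existsUnique : ∀ k ∈ Set.Icc (1 : ℤ) (n - 1),
    ∃! q : Side × ℤ × ℤ, q.2 ∈ M q.1 ∧ SameHalfMeander n P k q.2.1
  trivial_of_edge : ∀ s i j, (i, j) ∈ M s →
    (∃ s' k, IsHalfArc n (P s') k k ∧ SameHalfMeander n P i k) → i = j

/-! ### Meanders, loops, edges -/

/-- A meander: an orbit of the group `⟨f, g⟩` generated by two involutions. -/
def IsMeander (f g : Equiv.Perm ℤ) (E : Set ℤ) : Prop :=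
  ∃ x, E = MulAction.orbit (Subgroup.closure {f, g}) x

/-- An edge: a `⟨f, g⟩`-orbit that is also a `⟨f g⟩`-orbit. -/
def IsEdge (f g : Equiv.Perm ℤ) (E : Set ℤ) : Prop :=
  ∃ x, E = MulAction.orbit (Subgroup.closure {f, g}) x ∧
    E = MulAction.orbit (Subgroup.zpowers (f * g)) x

/-- A loop: a meander that is not an edge. -/
def IsLoop (f g : Equiv.Perm ℤ) (E : Set ℤ) : Prop := IsMeander f g E ∧ ¬ IsEdge f g E

/-! ### Anti-Toeplitz involutions and the modified involutions

In a component `[l, r]` the unmodified involution `κ` is `x ↦ l + r - x`.  A half-integer arc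
joining `i + 1/2` to `j + 1/2` (`i + j = l + r - 1`) marks the unmodified integer arc joining
`i` to `κ(i) = j + 1`. -/

/-- The unmodified integer arc joining `i < κ(i) = l + r - i` in the component `[l, r]` is marked. -/
def IsMarkedArc (M : Set (ℤ × ℤ)) (l r i : ℤ) : Prop := (i, l + r - 1 - i) ∈ M

/-- `[u, v]` is a connected component of the set of the left ends of the marked integer arcs of the
component `[l, r]`. -/
def IsMarkedRun (M : Set (ℤ × ℤ)) (l r u v : ℤ) : Prop :=
  l ≤ u ∧ u ≤ v ∧ (∀ i, u ≤ i → i ≤ v → IsMarkedArc M l r i) ∧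
    ¬ IsMarkedArc M l r (u - 1) ∧ ¬ IsMarkedArc M l r (v + 1)

/-- The left half of the extended component of a marked run `[u, v]`: it is `[u, v + 1]`, except
that it is `[u, v]` when `v` and `κ(v) = v + 1` are the two middle points of `[l, r]`. -/
def leftHalf (l r u v : ℤ) : Set ℤ := Set.Icc u (if 2 * v + 1 = l + r then v else v + 1)

/-- The right half, the image of the left half under `κ`. -/
def rightHalf (l r u v : ℤ) : Set ℤ := (fun x => l + r - x) '' leftHalf l r u v

/-- The extended component of a marked run. -/
def extendedComponent (l r u v : ℤ) : Set ℤ := leftHalf l r u v ∪ rightHalf l r u v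

/-- The marked run `[u, v]` reaches the centre of `[l, r]`: its last element is the last of the
`⌊(r - l + 1) / 2⌋` left ends of non-trivial arcs of `κ`. -/
def IsCentralRun (l r v : ℤ) : Prop := v - l + 1 = (r - l + 1) / 2

/-- `τ` acts on the extended component of the marked run `[u, v]` of `[l, r]` as an anti-Toeplitz
involution. (The first two conditions force the extended component to be stable under `τ`.) -/
structure IsAntiToeplitz (τ : Equiv.Perm ℤ) (l r u v : ℤ) : Prop where
  loop : ¬ IsCentralRun l r v → IsLoop (Equiv.subLeft (l + r)) τ (extendedComponent l r u v)
  edge : IsCentralRun l r v → IsEdge (Equiv.subLeft (l + r)) τ (extendedComponent l r u v)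
  opposite : ∀ x ∈ extendedComponent l r u v, τ x ≠ x →
    (x ∈ leftHalf l r u v ∧ τ x ∈ rightHalf l r u v) ∨
    (τ x ∈ leftHalf l r u v ∧ x ∈ rightHalf l r u v)

/-- `τ` is a modified involution of `[1, n]` for the partition given by `Q` and the set `M` of marked
half-integer arcs: in each component `[l, r]` it is an anti-Toeplitz involution on every extended
component of the set of markings, and it is `x ↦ l + r - x` elsewhere. -/
structure IsModifiedInvolution (n : ℕ) (Q : Set ℤ) (M : Set (ℤ × ℤ)) (τ : Equiv.Perm ℤ) : Prop where
  involutive : Function.Involutive τ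
  outside : ∀ x, x ∉ Set.Icc (1 : ℤ) n → τ x = x
  antiToeplitz : ∀ l r u v, IsComponent n Q l r → IsMarkedRun M l r u v → IsAntiToeplitz τ l r u v
  unmodified : ∀ l r, IsComponent n Q l r → ∀ x ∈ Set.Icc l r,
    (∀ u v, IsMarkedRun M l r u v → x ∉ extendedComponent l r u v) → τ x = l + r - x

/-! ### Directed arcs of an edge

From now on `σ above`, `σ below` are the two modified involutions.  A directed arc from `x` to `y`
is the pair `(x, y)`; it represents the root `ε_x - ε_y`. -/

/-- The directed arcs `S = S⁺ ∪ S⁻`: the non-trivial arcs of `σ above`, pointing from left to right,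
and those of `σ below`, pointing from right to left. -/
def S (σ : Side → Equiv.Perm ℤ) : Set (ℤ × ℤ) :=
  {p | p.1 < p.2 ∧ σ .above p.1 = p.2} ∪ {p | p.2 < p.1 ∧ σ .below p.1 = p.2}

/-- The directed arcs of `S` between points of the edge `E`. -/
def edgeArcs (σ : Side → Equiv.Perm ℤ) (E : Set ℤ) : Set (ℤ × ℤ) :=
  {p ∈ S σ | p.1 ∈ E ∧ p.2 ∈ E}

/-- `a` is one of the two end-points of the non-trivial edge `E`. -/
def IsEdgeEnd (σ : Side → Equiv.Perm ℤ) (E : Set ℤ) (a : ℤ) : Prop :=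
  a ∈ E ∧ ∃ s, σ s a = a

open Classical in
/-- The side of the arc joining `φ(t)` to `φ(t+1)` on the edge starting at `a`, `t ≥ 1`; sides
alternate, and the first arc is on the side whose involution does not fix `a`. -/
noncomputable def arcSide (σ : Side → Equiv.Perm ℤ) (a : ℤ) : ℕ → Side
  | 0 => if σ .above a = a then .above else .below
  | t + 1 => (arcSide σ a t).flip

/-- The enumeration `φ(1) = a, φ(2), ..., φ(e)` of the edge starting at `a` (the value at `0` is
not used). -/
noncomputable def phi (σ : Side → Equiv.Perm ℤ) (a : ℤ) : ℕ → ℤ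
  | 0 => a
  | 1 => a
  | t + 2 => σ (arcSide σ a (t + 1)) (phi σ a (t + 1))

section Straightening

variable (n : ℕ) (P : Side → Set ℤ) (σ : Side → Equiv.Perm ℤ) (a : ℤ) (e : ℕ) (sg : ℕ → ℤ)

/-- `φ(t)` is an internal turning point of the edge. -/
def IsInternalTurning (t : ℕ) : Prop :=
  1 < t ∧ t < e ∧ (phi σ a t - phi σ a (t - 1)) * (phi σ a t - phi σ a (t + 1)) < 0

/-- `φ(t)` is a turning point of the edge: an end-point or an internal turning point. -/
def IsTurning (t : ℕ) : Prop := t = 1 ∨ t = e ∨ IsInternalTurning σ a e t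

/-- `φ(t)` is a source (type `A`): a turning point at which no arc of `S` arrives. -/
def IsSource (t : ℕ) : Prop := IsTurning σ a e t ∧ ∀ y, (y, phi σ a t) ∉ S σ

/-- `φ(t)` is a sink (type `B`): a turning point from which no arc of `S` departs. -/
def IsSink (t : ℕ) : Prop := IsTurning σ a e t ∧ ∀ y, (phi σ a t, y) ∉ S σ

/-- `β_t = ε_{φ(t)} - ε_{φ(t+1)}`. -/
noncomputable def beta (t : ℕ) : ℤ → ℤ := root (phi σ a t) (phi σ a (t + 1))

/-- The rule for the signature `sg` at the internal turning points `φ(t)`: `sg t = 1` means that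
the boundary value assigned to `φ(t)` and marked is `β_{t-1}`, and `sg t = -1` that it is `β_t`.
If exactly one of the two is nil, the other one is marked; if both are nil, `β_{t-1}` is marked;
if neither is nil, the choice is free. -/
def IsSignature : Prop :=
  ∀ t, IsInternalTurning σ a e t →
    (sg t = 1 ∨ sg t = -1) ∧
    (IsNil n P (beta σ a (t - 1)) → IsNil n P (beta σ a t) → sg t = 1) ∧
    (IsNil n P (beta σ a (t - 1)) → ¬ IsNil n P (beta σ a t) → sg t = -1) ∧
    (¬ IsNil n P (beta σ a (t - 1)) → IsNil n P (beta σ a t) → sg t = 1)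

/-- `β_i` is marked. -/
def IsMarkedValue (i : ℕ) : Prop :=
  ∃ t, IsInternalTurning σ a e t ∧ ((sg t = 1 ∧ i + 1 = t) ∨ (sg t = -1 ∧ i = t))

/-- `φ(s)` is the turning point crossed by the external arc assigned to the internal turning point
`φ(t)`.  Here `same` is the type (source or sink) of `φ(t)` and `opp` is the opposite type.
If `sg t = 1`, it is the first turning point of opposite type after `φ(t)`.  If `sg t = -1`, it is
the first turning point of opposite type after the last internal turning point `φ(r)`, `r < t`, of
the same type and of negative signature, and, if there is no such `φ(r)`, the first turning point
of opposite type. -/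
def Crosses (same opp : ℕ → Prop) (t s : ℕ) : Prop :=
  (sg t = 1 ∧ IsLeast {s | opp s ∧ t < s} s) ∨
  (sg t = -1 ∧
    IsLeast {s | opp s ∧ ∀ r < t, IsInternalTurning σ a e r → same r → sg r = -1 → r < s} s)

/-- The index of the end-point other than `φ(t)` of the marked short line assigned to `φ(t)`. -/
def otherEnd (t : ℕ) : ℕ := if sg t = 1 then t - 1 else t + 1

/-- The directed external arcs.  The one assigned to an internal turning point `φ(t)` joins the other
end of the deleted short line to the turning point crossed, with the arrow at the other end
pointing as on the deleted line: towards it if `φ(t)` is a source, away from it if `φ(t)` is a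
sink. -/
def externalArcs : Set (ℤ × ℤ) :=
  {p | ∃ t s, IsInternalTurning σ a e t ∧
    ((IsSource σ a e t ∧ Crosses σ a e sg (IsSource σ a e) (IsSink σ a e) t s ∧
        p = (phi σ a s, phi σ a (otherEnd sg t))) ∨
     (IsSink σ a e t ∧ Crosses σ a e sg (IsSink σ a e) (IsSource σ a e) t s ∧
        p = (phi σ a (otherEnd sg t), phi σ a s)))}

/-- The short directed arcs `ε_i β_i ∈ S` that are not marked. -/
def unmarkedArcs : Set (ℤ × ℤ) :=
  {p ∈ S σ | ∃ i, 1 ≤ i ∧ i < e ∧ ¬ IsMarkedValue σ a e sg i ∧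
    (p = (phi σ a i, phi σ a (i + 1)) ∨ p = (phi σ a (i + 1), phi σ a i))}

/-- The directed arcs of the straightened edge `E^*`; they represent the roots `β_i^*`. -/
def straightenedArcs : Set (ℤ × ℤ) := unmarkedArcs σ a e sg ∪ externalArcs σ a e sg

end Straightening

/-- The set `A` of directed arcs forms a single edge passing through all the points of `V`, with all
its arrows aligned, with starting point `x` and finishing point `y`. -/
def IsAlignedEdge (A : Set (ℤ × ℤ)) (V : Set ℤ) (x y : ℤ) : Prop :=
  ∃ (p : ℕ) (ψ : ℕ → ℤ), 2 ≤ p ∧ Set.InjOn ψ (Set.Icc 1 p) ∧ ψ '' Set.Icc 1 p = V ∧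
    A = {q | ∃ j, 1 ≤ j ∧ j < p ∧ q = (ψ j, ψ (j + 1))} ∧ ψ 1 = x ∧ ψ p = y

end Biparabolic

/-! The proof has two independent halves. The first is combinatorial and shows that `E^*` is a
directed path. Number the points of the edge by indices and suppose that the part up to a turning
index `t` is already straightened into a directed path. Let `m` be the next turning index (or the
last index). The run from `t` to `m` is then attached at one end of the path if the signature at `t`
is negative, and inserted into the deleted arc `t - 1, t` otherwise. The rule defining external arcs
says exactly that the new joint falls on the current end (`IsStraightening.exists_step`,
`exists_isStraightening`). A short arc might be deleted from both of its ends, but an arc between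
adjacent turning points is nil (`IsEnumeration.isNil_of_turn`), and the signature rule then excludes
this. The path leads from a source `x` to a sink `y`.

The second half shows that `ε_y - ε_x` is not in `R` (`IsEnumeration.not_rRel`). Compare the centres
of the intervals above and below a point. Uniqueness of marked arcs on half-integer meanders gives
(lower centre) ≤ (upper centre) at a source and the reverse at a sink, with equality only at an
end-point of `E`. If `ε_y - ε_x` were in `R`, then `x` and `y` would share an interval on one side,
and their order would close a cycle of inequalities between centres. So both sides are shared, the
two intervals are concentric, and `x`, `y` are the end-points of `E`.

Parity excludes this (`IsConcentric.false`). Count modulo 2 the points of `E` to the left of a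
half-integer point, corrected at the common centre if each involution fixes one point of `E`. This
height agrees at the ends of an unmarked half-integer arc, because the points between pair off;
since a meander has only one marked arc, it agrees on marked arcs too. Hence `E` is stable under the
unmodified reflections. It therefore contains or avoids whole extended components, so `i ∈ E ↔ i + 1
∈ E` at marked arcs, then along every half-integer meander, and `E = [1, n]`. A parity count in an
adjacent interval makes the two concentric intervals coincide; they are then `[1, n]`, against the
assumption on `π⁺ ∩ π⁻`.

If `E = E^*`, all arcs of the path represent roots of `R`, and `RRel.trans` puts their sum in `R`.
-/

namespace Biparabolic

/-! ### Components -/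

section Components

variable {n : ℕ} {Q : Set ℤ}

/-- All the simple roots between `x` and `y`, `x < y`, lie in `Q`. -/
def Linked (Q : Set ℤ) (x y : ℤ) : Prop := ∀ i, x ≤ i → i < y → i ∈ Q

lemma IsComponent.linked {l r x y : ℤ} (h : IsComponent n Q l r) (hx : l ≤ x) (hy : y ≤ r) :
    Linked Q x y := fun i h₁ h₂ => h.2.2.2.1 i (by lia) (by lia)

lemma IsComponent.le_of_linked {l r x y : ℤ} (h : IsComponent n Q l r) (hx : x ≤ r)
    (hl : Linked Q x y) : y ≤ r := by
  by_contra hc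
  exact h.2.2.2.2.2 (hl r hx (by lia))

lemma IsComponent.ge_of_linked {l r x y : ℤ} (h : IsComponent n Q l r) (hy : l ≤ y)
    (hl : Linked Q x y) : l ≤ x := by
  by_contra hc
  exact h.2.2.2.2.1 (hl (l - 1) (by lia) (by lia))

lemma IsComponent.eq_of_mem {l r l' r' x : ℤ} (h : IsComponent n Q l r)
    (h' : IsComponent n Q l' r') (hx : l ≤ x) (hx' : x ≤ r) (hy : l' ≤ x) (hy' : x ≤ r') :
    l = l' ∧ r = r' :=
  ⟨le_antisymm (h.ge_of_linked hx (h'.linked le_rfl hy'))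
      (h'.ge_of_linked hy (h.linked le_rfl hx')),
    le_antisymm (h'.le_of_linked hy' (h.linked hx le_rfl))
      (h.le_of_linked hx' (h'.linked hy le_rfl))⟩

/-- Intervals with the same centre meet. Hence a half-integer arc, recorded only by its ends,
determines its interval. -/
lemma IsComponent.eq_of_add_eq {l r l' r' : ℤ} (h : IsComponent n Q l r)
    (h' : IsComponent n Q l' r') (hs : l + r = l' + r') : l = l' ∧ r = r' := by
  have h₁ := h.2.1
  have h₂ := h'.2.1
  rcases le_total l l' with hl | hl
  · exact h.eq_of_mem h' hl (by lia) le_rfl h₂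
  · exact h.eq_of_mem h' le_rfl h₁ hl (by lia)

lemma exists_isComponent (hQ : Q ⊆ Set.Icc (1 : ℤ) (n - 1)) {x : ℤ} (h1 : 1 ≤ x) (hn : x ≤ n) :
    ∃ l r, IsComponent n Q l r ∧ l ≤ x ∧ x ≤ r := by
  obtain ⟨l, ⟨hl, hl'⟩, hlm⟩ := Int.exists_greatest_of_bdd (P := fun i => i < x ∧ i ∉ Q)
    ⟨x, fun z hz => hz.1.le⟩ ⟨0, by lia, fun h => by have := (hQ h).1; lia⟩
  obtain ⟨r, ⟨hr, hr'⟩, hrm⟩ := Int.exists_least_of_bdd (P := fun i => x ≤ i ∧ i ∉ Q)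
    ⟨x, fun z hz => hz.1⟩ ⟨n, by lia, fun h => by have := (hQ h).2; lia⟩
  have hl0 : 0 ≤ l := hlm 0 ⟨by lia, fun h => by have := (hQ h).1; lia⟩
  have hrn : r ≤ n := hrm n ⟨by lia, fun h => by have := (hQ h).2; lia⟩
  refine ⟨l + 1, r, ⟨by lia, by lia, hrn, fun i h₁ h₂ => ?_, by simpa using hl', hr'⟩, by lia, hr⟩
  by_contra hi
  rcases lt_or_ge i x with h | h
  · have := hlm i ⟨h, hi⟩; lia
  · have := hrm i ⟨h, hi⟩; lia

end Components

/-! ### The roots in `R` -/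

section Roots

variable {n : ℕ} {P : Side → Set ℤ}

/-- `ε_x - ε_y ∈ R` in terms of the points `x ≠ y`. -/
def RRel (P : Side → Set ℤ) (x y : ℤ) : Prop :=
  (x < y ∧ Linked (P .above) x y) ∨ (y < x ∧ Linked (P .below) y x)

/-- In the mixed cases the shorter segment cancels, and what remains uses only links of the longer
one. -/
lemma RRel.trans {x y z : ℤ} (h : RRel P x y) (h' : RRel P y z) (hxz : x ≠ z) : RRel P x z := by
  rcases h with ⟨h₁, h₂⟩ | ⟨h₁, h₂⟩ <;> rcases h' with ⟨h₃, h₄⟩ | ⟨h₃, h₄⟩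
  · refine .inl ⟨h₁.trans h₃, fun i hi hi' => ?_⟩
    rcases lt_or_ge i y with h | h
    exacts [h₂ i hi h, h₄ i h hi']
  · rcases lt_or_gt_of_ne hxz with h | h
    · exact .inl ⟨h, fun i hi hi' => h₂ i hi (hi'.trans h₃)⟩
    · exact .inr ⟨h, fun i hi hi' => h₄ i hi (hi'.trans h₁)⟩
  · rcases lt_or_gt_of_ne hxz with h | h
    · exact .inl ⟨h, fun i hi hi' => h₄ i (h₁.le.trans hi) hi'⟩
    · exact .inr ⟨h, fun i hi hi' => h₂ i (h₃.le.trans hi) hi'⟩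
  · refine .inr ⟨h₃.trans h₁, fun i hi hi' => ?_⟩
    rcases lt_or_ge i y with h | h
    exacts [h₄ i hi h, h₂ i h hi']

lemma sum_root (k : ℤ) {x y : ℤ} (hx : 1 ≤ x) (hy : 1 ≤ y) :
    ∑ i ∈ Finset.Icc 1 k, root x y i = (if x ≤ k then 1 else 0) - (if y ≤ k then 1 else 0) := by
  simp only [root, Pi.sub_apply, Finset.sum_sub_distrib, Pi.single_apply, Finset.sum_ite_eq',
    Finset.mem_Icc, hx, hy, true_and]

/-- The partial sum up to `k` extracts the coefficient of `α_k`. -/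
lemma sum_closure_simpleRoots {Q : Set ℤ} (hQ : Q ⊆ Set.Icc (1 : ℤ) (n - 1)) {v : ℤ → ℤ}
    (hv : v ∈ AddSubmonoid.closure (simpleRoots Q)) (k : ℤ) :
    0 ≤ ∑ i ∈ Finset.Icc 1 k, v i ∧ (k ∉ Q → ∑ i ∈ Finset.Icc 1 k, v i = 0) := by
  induction hv using AddSubmonoid.closure_induction with
  | mem v hv =>
    obtain ⟨i, hi, rfl⟩ := hv
    have h1 := (hQ hi).1
    simp only
    rw [sum_root k h1 (by lia)]
    refine ⟨by split_ifs <;> lia, fun hk => ?_⟩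
    have : i ≠ k := fun h => hk (h ▸ hi)
    split_ifs <;> lia
  | zero => simp
  | add u v _ _ hu hv =>
    simp only [Pi.add_apply, Finset.sum_add_distrib]
    exact ⟨add_nonneg hu.1 hv.1, fun hk => by rw [hu.2 hk, hv.2 hk, add_zero]⟩

lemma root_mem_closure_of_linked {Q : Set ℤ} {x y : ℤ} (hxy : x < y) (h : Linked Q x y) :
    root x y ∈ AddSubmonoid.closure (simpleRoots Q) := by
  revert h
  induction y, hxy using Int.leInduction with
  | base =>
    intro h
    exact AddSubmonoid.subset_closure ⟨x, h x le_rfl (by lia), rfl⟩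
  | succ y hxy ih =>
    intro h
    have : root x (y + 1) = root x y + root y (y + 1) := by simp [root]
    rw [this]
    exact add_mem (ih fun i hi hi' => h i hi (by lia))
      (AddSubmonoid.subset_closure ⟨y, h y (by lia) (by lia), rfl⟩)

lemma linked_of_root_mem_closure {Q : Set ℤ} (hQ : Q ⊆ Set.Icc (1 : ℤ) (n - 1)) {x y : ℤ}
    (hx : 1 ≤ x) (hy : 1 ≤ y) (hxy : x ≠ y)
    (h : root x y ∈ AddSubmonoid.closure (simpleRoots Q)) : x < y ∧ Linked Q x y := by
  have hs := fun k => sum_closure_simpleRoots hQ h k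
  simp only [sum_root _ hx hy] at hs
  have hlt : x < y := by
    by_contra hc
    have := (hs y).1
    rw [if_neg (by lia), if_pos le_rfl] at this
    lia
  refine ⟨hlt, fun i hi hi' => ?_⟩
  by_contra hc
  have := (hs i).2 hc
  rw [if_pos hi, if_neg (by lia)] at this
  lia

lemma neg_root (x y : ℤ) : -root x y = root y x := by simp [root]

lemma root_mem_Delta {x y : ℤ} (hx : x ∈ Set.Icc (1 : ℤ) n) (hy : y ∈ Set.Icc (1 : ℤ) n)
    (hxy : x ≠ y) : root x y ∈ Delta n := ⟨x, hx, y, hy, hxy, rfl⟩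

lemma root_mem_R (hQ : ∀ s, P s ⊆ Set.Icc (1 : ℤ) (n - 1)) {x y : ℤ}
    (hx : x ∈ Set.Icc (1 : ℤ) n) (hy : y ∈ Set.Icc (1 : ℤ) n) (hxy : x ≠ y) :
    root x y ∈ R n P ↔ RRel P x y := by
  constructor
  · rintro ⟨h | h, -⟩
    · exact .inl (linked_of_root_mem_closure (hQ _) hx.1 hy.1 hxy h)
    · rw [Set.mem_neg, neg_root] at h
      exact .inr (linked_of_root_mem_closure (hQ _) hy.1 hx.1 hxy.symm h)
  · rintro (⟨h, h'⟩ | ⟨h, h'⟩)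
    · exact ⟨.inl (root_mem_closure_of_linked h h'), root_mem_Delta hx hy hxy⟩
    · refine ⟨.inr ?_, root_mem_Delta hx hy hxy⟩
      rw [Set.mem_neg, neg_root]
      exact root_mem_closure_of_linked h h'

lemma root_mem_neg_K (hQ : ∀ s, P s ⊆ Set.Icc (1 : ℤ) (n - 1)) {x y : ℤ}
    (hx : x ∈ Set.Icc (1 : ℤ) n) (hy : y ∈ Set.Icc (1 : ℤ) n) (hxy : x ≠ y) :
    root x y ∈ -K n P ↔ ¬ RRel P y x := by
  rw [Set.mem_neg, neg_root, K, Set.mem_sdiff, root_mem_R hQ hy hx hxy.symm]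
  exact and_iff_right (root_mem_Delta hy hx hxy.symm)

lemma isNil_root (hQ : ∀ s, P s ⊆ Set.Icc (1 : ℤ) (n - 1)) {x y : ℤ}
    (hx : x ∈ Set.Icc (1 : ℤ) n) (hy : y ∈ Set.Icc (1 : ℤ) n) (hxy : x ≠ y) :
    IsNil n P (root x y) ↔ ¬ (RRel P x y ∧ RRel P y x) := by
  rw [IsNil, Set.mem_union, root_mem_neg_K hQ hx hy hxy, K, Set.mem_sdiff, root_mem_R hQ hx hy hxy,
    and_iff_right (root_mem_Delta hx hy hxy)]
  tauto

lemma neg_K_inter_R : -K n P ∩ R n P = -RStar n P := by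
  have hD : ∀ v ∈ R n P, -v ∈ Delta n := by
    rintro v ⟨-, x, hx, y, hy, hxy, rfl⟩
    rw [neg_root]
    exact root_mem_Delta hy hx hxy.symm
  ext v
  simp only [K, RStar, Set.mem_inter_iff, Set.mem_neg, Set.mem_sdiff, Set.mem_union, neg_neg]
  have := hD v
  tauto

end Roots

end Biparabolic

namespace Biparabolic

/-! ### Orbits of two involutions -/

section Dihedral

variable {f g : Equiv.Perm ℤ} {E : Set ℤ}

lemma apply_mem_orbit {x y : ℤ} (h : y ∈ MulAction.orbit (Subgroup.closure {f, g}) x) :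
    f y ∈ MulAction.orbit (Subgroup.closure {f, g}) x ∧
      g y ∈ MulAction.orbit (Subgroup.closure {f, g}) x := by
  have key : ∀ k ∈ ({f, g} : Set (Equiv.Perm ℤ)),
      k y ∈ MulAction.orbit (Subgroup.closure {f, g}) x := fun k hk =>
    MulAction.mem_orbit_of_mem_orbit (⟨k, Subgroup.subset_closure hk⟩ : Subgroup.closure {f, g}) h
  exact ⟨key f (by simp), key g (by simp)⟩

lemma orbit_subset (hf : Function.Involutive f) (hg : Function.Involutive g) {A : Set ℤ}
    (hfA : ∀ y ∈ A, f y ∈ A) (hgA : ∀ y ∈ A, g y ∈ A) {x : ℤ} (hx : x ∈ A) :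
    MulAction.orbit (Subgroup.closure {f, g}) x ⊆ A := by
  rintro _ ⟨⟨k, hk⟩, rfl⟩
  change k x ∈ A
  have key : ∀ y ∈ A, k y ∈ A ∧ k⁻¹ y ∈ A := by
    induction hk using Subgroup.closure_induction with
    | mem k hk =>
      have inv : ∀ k : Equiv.Perm ℤ, Function.Involutive k → ∀ y, k⁻¹ y = k y := fun k hk y => by
        rw [Equiv.Perm.inv_eq_iff_eq, hk]
      rcases hk with rfl | rfl
      · exact fun y hy => ⟨hfA y hy, by rw [inv _ hf]; exact hfA y hy⟩
      · exact fun y hy => ⟨hgA y hy, by rw [inv _ hg]; exact hgA y hy⟩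
    | one => simp
    | mul a b _ _ ha hb =>
      intro y hy
      simp only [mul_inv_rev, Equiv.Perm.mul_apply]
      exact ⟨(ha _ (hb y hy).1).1, (hb _ (ha y hy).2).2⟩
    | inv a _ ha => exact fun y hy => by simpa using (ha y hy).symm
  exact (key x hx).1

lemma semiconjBy_mul (hf : Function.Involutive f) (hg : Function.Involutive g) :
    SemiconjBy f (f * g) (f * g)⁻¹ ∧ SemiconjBy g (f * g) (f * g)⁻¹ := by
  have hf2 : f⁻¹ = f := Equiv.ext fun y => by rw [Equiv.Perm.inv_eq_iff_eq, hf]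
  have hg2 : g⁻¹ = g := Equiv.ext fun y => by rw [Equiv.Perm.inv_eq_iff_eq, hg]
  constructor <;> rw [SemiconjBy, mul_inv_rev, hf2, hg2]
  · rw [mul_assoc g f f, show f * f = 1 from Equiv.ext hf, mul_one, ← mul_assoc,
      show f * f = 1 from Equiv.ext hf, one_mul]
  · rw [mul_assoc]

/-- Each generator inverts the rotation `f * g`. -/
lemma apply_zpow (hf : Function.Involutive f) (hg : Function.Involutive g) (k : ℤ) (y : ℤ) :
    f (((f * g) ^ k) y) = ((f * g) ^ (-k)) (f y) ∧ g (((f * g) ^ k) y) = ((f * g) ^ (-k)) (g y) := by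
  have h := semiconjBy_mul hf hg
  have h1 := (h.1.zpow_right k).eq
  have h2 := (h.2.zpow_right k).eq
  rw [inv_zpow'] at h1 h2
  exact ⟨DFunLike.congr_fun h1 y, DFunLike.congr_fun h2 y⟩

lemma mem_orbit_zpowers {y x : ℤ} :
    y ∈ MulAction.orbit (Subgroup.zpowers (f * g)) x ↔ ∃ k : ℤ, ((f * g) ^ k) x = y := by
  constructor
  · rintro ⟨⟨_, k, rfl⟩, rfl⟩
    exact ⟨k, rfl⟩
  · rintro ⟨k, rfl⟩
    exact ⟨⟨_, k, rfl⟩, rfl⟩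

/-- The generator fixing `y` sends `(f * g)^k y` to `(f * g)^(-k) y`, and the other differs from it
by a factor `(f * g)^(±1)`; so the cyclic orbit is already stable under both. -/
lemma orbit_eq_of_fixed (hf : Function.Involutive f) (hg : Function.Involutive g) {y : ℤ}
    (hy : f y = y ∨ g y = y) :
    MulAction.orbit (Subgroup.closure {f, g}) y = MulAction.orbit (Subgroup.zpowers (f * g)) y := by
  have hfg : ∀ z, f z = (f * g) (g z) := fun z => by rw [Equiv.Perm.mul_apply, hg]
  have hgf : ∀ z, g z = ((f * g) ^ (-1 : ℤ)) (f z) := fun z => by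
    rw [zpow_neg_one, Equiv.Perm.eq_inv_iff_eq, Equiv.Perm.mul_apply, hg]
  have add : ∀ (i j : ℤ) z, ((f * g) ^ i) (((f * g) ^ j) z) = ((f * g) ^ (i + j)) z := fun i j z => by
    rw [zpow_add, Equiv.Perm.mul_apply]
  apply Set.Subset.antisymm
  · apply orbit_subset hf hg _ _ (MulAction.mem_orbit_self y)
    · intro z hz
      obtain ⟨k, rfl⟩ := mem_orbit_zpowers.1 hz
      rw [mem_orbit_zpowers]
      rcases hy with h | h
      · exact ⟨-k, by rw [(apply_zpow hf hg k y).1, h]⟩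
      · refine ⟨1 + -k, ?_⟩
        rw [hfg, (apply_zpow hf hg k y).2, h, ← add, zpow_one]
    · intro z hz
      obtain ⟨k, rfl⟩ := mem_orbit_zpowers.1 hz
      rw [mem_orbit_zpowers]
      rcases hy with h | h
      · refine ⟨-1 + -k, ?_⟩
        rw [hgf, (apply_zpow hf hg k y).1, h, ← add]
      · exact ⟨-k, by rw [(apply_zpow hf hg k y).2, h]⟩
  · rintro _ ⟨⟨k, hk⟩, rfl⟩
    have : k ∈ Subgroup.closure {f, g} := by
      refine (Subgroup.zpowers_le.2 ?_) hk
      exact mul_mem (Subgroup.subset_closure (by simp)) (Subgroup.subset_closure (by simp))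
    exact ⟨⟨k, this⟩, rfl⟩

lemma isEdge_of_fixed (hf : Function.Involutive f) (hg : Function.Involutive g)
    (hE : IsMeander f g E) {y : ℤ} (hyE : y ∈ E) (hy : f y = y ∨ g y = y) : IsEdge f g E := by
  obtain ⟨x, rfl⟩ := hE
  have : MulAction.orbit (Subgroup.closure {f, g}) x = MulAction.orbit (Subgroup.closure {f, g}) y :=
    (MulAction.orbit_eq_iff.2 hyE).symm
  exact ⟨y, this, this.trans (orbit_eq_of_fixed hf hg hy)⟩

/-- If `f x = (f * g)^k x`, the point halfway, `(f * g)^m x` with `k = 2m` or `k = 2m + 1`, is fixed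
by `f` or by `g` respectively. -/
lemma IsEdge.exists_fixed (hf : Function.Involutive f) (hg : Function.Involutive g)
    (hE : IsEdge f g E) : ∃ y ∈ E, f y = y ∨ g y = y := by
  obtain ⟨x, h₁, h₂⟩ := hE
  have add : ∀ (i j : ℤ) z, ((f * g) ^ i) (((f * g) ^ j) z) = ((f * g) ^ (i + j)) z := fun i j z => by
    rw [zpow_add, Equiv.Perm.mul_apply]
  have hfx : f x ∈ E := h₁ ▸ (apply_mem_orbit (MulAction.mem_orbit_self x)).1
  rw [h₂] at hfx
  obtain ⟨k, hk⟩ := mem_orbit_zpowers.1 hfx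
  obtain ⟨m, rfl | rfl⟩ := Int.even_or_odd' k
  · refine ⟨((f * g) ^ m) x, h₂ ▸ mem_orbit_zpowers.2 ⟨m, rfl⟩, .inl ?_⟩
    rw [(apply_zpow hf hg m x).1, ← hk, add]
    congr 2; ring
  · refine ⟨((f * g) ^ m) x, h₂ ▸ mem_orbit_zpowers.2 ⟨m, rfl⟩, .inr ?_⟩
    have hgx : g x = ((f * g) ^ (-1 : ℤ)) (f x) := by
      rw [zpow_neg_one, Equiv.Perm.eq_inv_iff_eq, Equiv.Perm.mul_apply, hg]
    rw [(apply_zpow hf hg m x).2, hgx, ← hk, add, add]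
    congr 2; ring

end Dihedral

/-! ### Modified involutions -/

/-- A modified involution on one side of the line, together with the data it is built from. -/
structure IsLayer (n : ℕ) (Q : Set ℤ) (M : Set (ℤ × ℤ)) (τ : Equiv.Perm ℤ) : Prop where
  subset : Q ⊆ Set.Icc (1 : ℤ) (n - 1)
  isHalfArc : ∀ i j, (i, j) ∈ M → IsHalfArc n Q i j
  isModified : IsModifiedInvolution n Q M τ

lemma subLeft_involutive (c : ℤ) : Function.Involutive (Equiv.subLeft c) := fun x => by simp

lemma mem_rightHalf {l r u v x : ℤ} : x ∈ rightHalf l r u v ↔ l + r - x ∈ leftHalf l r u v := by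
  constructor
  · rintro ⟨y, hy, rfl⟩
    simpa using hy
  · exact fun h => ⟨_, h, by simp⟩

lemma mem_extended {l r u v x : ℤ} :
    x ∈ extendedComponent l r u v ↔ x ∈ leftHalf l r u v ∨ l + r - x ∈ leftHalf l r u v := by
  rw [extendedComponent, Set.mem_union, mem_rightHalf]

section Layer

variable {n : ℕ} {Q : Set ℤ} {M : Set (ℤ × ℤ)} {τ : Equiv.Perm ℤ} {l r : ℤ}

lemma IsLayer.marked_bounds (L : IsLayer n Q M τ) (hc : IsComponent n Q l r) {i : ℤ}
    (h : IsMarkedArc M l r i) : l ≤ i ∧ 2 * i ≤ l + r - 1 := by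
  obtain ⟨l', r', hc', h₁, h₂, h₃⟩ := L.isHalfArc _ _ h
  obtain ⟨rfl, rfl⟩ := hc.eq_of_add_eq hc' (by lia)
  exact ⟨h₁, by lia⟩

lemma IsLayer.mem_leftHalf (L : IsLayer n Q M τ) (hc : IsComponent n Q l r) {u v : ℤ}
    (h : IsMarkedRun M l r u v) {x : ℤ} :
    x ∈ leftHalf l r u v ↔ u ≤ x ∧ x ≤ v + 1 ∧ 2 * x ≤ l + r := by
  have := L.marked_bounds hc (h.2.2.1 v h.2.1 le_rfl)
  rw [leftHalf, Set.mem_Icc]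
  split_ifs <;> lia

lemma IsLayer.isMeander (L : IsLayer n Q M τ) (hc : IsComponent n Q l r) {u v : ℤ}
    (h : IsMarkedRun M l r u v) :
    IsMeander (Equiv.subLeft (l + r)) τ (extendedComponent l r u v) := by
  have ha := L.isModified.antiToeplitz l r u v hc h
  by_cases hv : IsCentralRun l r v
  · obtain ⟨x, hx, -⟩ := ha.edge hv
    exact ⟨x, hx⟩
  · exact (ha.loop hv).1

lemma IsLayer.apply_mem_extended (L : IsLayer n Q M τ) (hc : IsComponent n Q l r) {u v : ℤ}
    (h : IsMarkedRun M l r u v) {x : ℤ} (hx : x ∈ extendedComponent l r u v) :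
    τ x ∈ extendedComponent l r u v := by
  obtain ⟨y, hy⟩ := L.isMeander hc h
  rw [hy] at hx ⊢
  exact (apply_mem_orbit hx).2

/-- A set stable under the reflection and under `τ` contains the extended components it meets. -/
lemma IsLayer.extended_subset (L : IsLayer n Q M τ) (hc : IsComponent n Q l r) {u v : ℤ}
    (h : IsMarkedRun M l r u v) {A : Set ℤ} (h₁ : ∀ x ∈ A, l + r - x ∈ A) (h₂ : ∀ x ∈ A, τ x ∈ A)
    {x : ℤ} (hx : x ∈ extendedComponent l r u v) (hxA : x ∈ A) : extendedComponent l r u v ⊆ A := by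
  obtain ⟨y, hy⟩ := L.isMeander hc h
  rw [hy] at hx ⊢
  rw [← MulAction.orbit_eq_iff.2 hx]
  exact orbit_subset (subLeft_involutive _) L.isModified.involutive (by simpa using h₁) h₂ hxA

lemma IsLayer.cases (L : IsLayer n Q M τ) (hc : IsComponent n Q l r) {x : ℤ}
    (hx : l ≤ x) (hx' : x ≤ r) :
    τ x = l + r - x ∨ ∃ u v, IsMarkedRun M l r u v ∧ x ∈ extendedComponent l r u v := by
  by_contra! h
  exact h.1 (L.isModified.unmodified l r hc x ⟨hx, hx'⟩ h.2)

lemma IsLayer.extended_bounds (L : IsLayer n Q M τ) (hc : IsComponent n Q l r) {u v : ℤ}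
    (h : IsMarkedRun M l r u v) {x : ℤ} (hx : x ∈ extendedComponent l r u v) :
    u ≤ x ∧ x ≤ l + r - u := by
  have hu := h.1
  rw [mem_extended, L.mem_leftHalf hc h, L.mem_leftHalf hc h] at hx
  lia

/-- An inner interval of a component that is cut off by an unmarked half-integer arc is stable. -/
lemma IsLayer.apply_mem_inner (L : IsLayer n Q M τ) (hc : IsComponent n Q l r) {i : ℤ}
    (hi : l - 1 ≤ i) (hm : ¬ IsMarkedArc M l r i) {x : ℤ} (hx : i < x) (hx' : x < l + r - i) :
    i < τ x ∧ τ x < l + r - i := by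
  rcases L.cases hc (x := x) (by lia) (by lia) with h | ⟨u, v, h, hxX⟩
  · lia
  · have hiu : i < u := by
      by_contra hc'
      have hvi : v < i := by
        by_contra hc''
        exact hm (h.2.2.1 i (by lia) (by lia))
      rw [mem_extended, L.mem_leftHalf hc h, L.mem_leftHalf hc h] at hxX
      lia
    have := L.extended_bounds hc h (L.apply_mem_extended hc h hxX)
    lia

lemma IsLayer.apply_mem (L : IsLayer n Q M τ) (hc : IsComponent n Q l r) {x : ℤ}
    (hx : l ≤ x) (hx' : x ≤ r) : l ≤ τ x ∧ τ x ≤ r := by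
  have hm : ¬ IsMarkedArc M l r (l - 1) := fun h => by
    have := L.marked_bounds hc h
    lia
  have := L.apply_mem_inner hc le_rfl hm (x := x) (by lia) (by lia)
  lia

/-- Unmodified arcs are symmetric about the centre, and condition (ii) puts the ends of the other
arcs in opposite halves. -/
lemma IsLayer.crosses_centre (L : IsLayer n Q M τ) (hc : IsComponent n Q l r) {x : ℤ}
    (hx : l ≤ x) (hx' : x ≤ r) (hlt : x < τ x) : 2 * x ≤ l + r ∧ l + r ≤ 2 * τ x := by
  rcases L.cases hc hx hx' with h | ⟨u, v, h, hxX⟩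
  · lia
  · rcases (L.isModified.antiToeplitz l r u v hc h).opposite x hxX hlt.ne' with ⟨h₁, h₂⟩ | ⟨h₁, h₂⟩ <;>
    · rw [mem_rightHalf] at h₂
      rw [L.mem_leftHalf hc h] at h₁ h₂
      lia

lemma IsLayer.crosses_centre' (L : IsLayer n Q M τ) (hc : IsComponent n Q l r) {x : ℤ}
    (hx : l ≤ x) (hx' : x ≤ r) (hlt : τ x < x) : 2 * τ x ≤ l + r ∧ l + r ≤ 2 * x := by
  have h := L.apply_mem hc hx hx'
  have hi := L.isModified.involutive x
  have := L.crosses_centre hc h.1 h.2 (by rwa [hi])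
  rwa [hi] at this

/-- The reflection fixes the centre, so a moved centre lies in an extended component, whose run must
end at the innermost arc. -/
lemma IsLayer.marked_of_centre_moved (L : IsLayer n Q M τ) (hc : IsComponent n Q l r) {x : ℤ}
    (hx : 2 * x = l + r) (hne : τ x ≠ x) : (x - 1, x) ∈ M := by
  have := hc.2.1
  rcases L.cases hc (x := x) (by lia) (by lia) with h | ⟨u, v, h, hxX⟩
  · exact absurd (h.trans (by lia)) hne
  · have hb := L.marked_bounds hc (h.2.2.1 v h.2.1 le_rfl)
    rw [mem_extended, L.mem_leftHalf hc h, L.mem_leftHalf hc h] at hxX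
    have := h.2.2.1 v h.2.1 le_rfl
    rw [IsMarkedArc] at this
    convert this using 2 <;> lia

/-- A fixed point other than the centre lies in the extended component of a central run. -/
lemma IsLayer.exists_central (L : IsLayer n Q M τ) (hc : IsComponent n Q l r) {x : ℤ}
    (hx : l ≤ x) (hx' : x ≤ r) (hne : 2 * x ≠ l + r) (hfix : τ x = x) :
    ∃ u v, IsMarkedRun M l r u v ∧ x ∈ extendedComponent l r u v ∧
      ∀ i, u ≤ i → 2 * i ≤ l + r - 1 → IsMarkedArc M l r i := by
  rcases L.cases hc hx hx' with h | ⟨u, v, h, hxX⟩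
  · lia
  · refine ⟨u, v, h, hxX, fun i hi hi' => h.2.2.1 i hi ?_⟩
    -- A fixed point turns the orbit into an edge, which is allowed only for a central run.
    have hcen : IsCentralRun l r v := by
      by_contra hv
      have hl := (L.isModified.antiToeplitz l r u v hc h).loop hv
      exact hl.2 (isEdge_of_fixed (subLeft_involutive _) L.isModified.involutive hl.1 hxX
        (.inr hfix))
    rw [IsCentralRun] at hcen
    lia

/-- The run around a fixed point off the centre is central, so every arc nested inside that point or
its mirror image is marked. This is the main source of contradictions with the uniqueness of marked
arcs. -/
lemma IsLayer.marked_of_fixed (L : IsLayer n Q M τ) (hc : IsComponent n Q l r) {x : ℤ}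
    (hx : l ≤ x) (hx' : x ≤ r) (hne : 2 * x ≠ l + r) (hfix : τ x = x) {i : ℤ}
    (hi : x ≤ i ∨ l + r - x ≤ i) (hi' : 2 * i ≤ l + r - 1) : IsMarkedArc M l r i := by
  obtain ⟨u, v, h, hxX, hall⟩ := L.exists_central hc hx hx' hne hfix
  have := L.extended_bounds hc h hxX
  exact hall i (by lia) hi'

/-- The run of a marked arc. -/
lemma IsLayer.exists_run (L : IsLayer n Q M τ) (hc : IsComponent n Q l r) {i : ℤ}
    (h : IsMarkedArc M l r i) : ∃ u v, IsMarkedRun M l r u v ∧ u ≤ i ∧ i ≤ v := by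
  have hb := L.marked_bounds hc h
  obtain ⟨u, ⟨hu, hu'⟩, hum⟩ := Int.exists_greatest_of_bdd
    (P := fun k => k ≤ i ∧ ¬ IsMarkedArc M l r k) ⟨i, fun z hz => hz.1⟩
    ⟨l - 1, by lia, fun h => by have := L.marked_bounds hc h; lia⟩
  obtain ⟨v, ⟨hv, hv'⟩, hvm⟩ := Int.exists_least_of_bdd
    (P := fun k => i ≤ k ∧ ¬ IsMarkedArc M l r k) ⟨i, fun z hz => hz.1⟩
    ⟨r + 1, by have := hc.2.1; lia, fun h => by have := L.marked_bounds hc h; have := hc.2.1; lia⟩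
  have hui : u ≠ i := fun e => hu' (e ▸ h)
  have hvi : v ≠ i := fun e => hv' (e ▸ h)
  have hall : ∀ k, u + 1 ≤ k → k ≤ v - 1 → IsMarkedArc M l r k := by
    intro k h₁ h₂
    by_contra hk
    rcases le_total k i with h | h
    · have := hum k ⟨h, hk⟩; lia
    · have := hvm k ⟨h, hk⟩; lia
  refine ⟨u + 1, v - 1, ⟨?_, by lia, hall, by simpa using hu', by simpa using hv'⟩, by lia, by lia⟩
  exact (L.marked_bounds hc (hall (u + 1) le_rfl (by lia))).1

/-- A marked trivial half-integer arc produces a fixed point. -/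
lemma IsLayer.exists_fixed_of_marked_trivial (L : IsLayer n Q M τ) {k : ℤ} (h : (k, k) ∈ M) :
    ∃ l r x, IsComponent n Q l r ∧ 2 * k + 1 = l + r ∧ l ≤ x ∧ x ≤ r ∧ τ x = x := by
  obtain ⟨l, r, hc, h₁, -, h₃⟩ := L.isHalfArc _ _ h
  have hm : IsMarkedArc M l r k := by
    rw [IsMarkedArc]; convert h using 2; lia
  obtain ⟨u, v, hr, hu, hv⟩ := L.exists_run hc hm
  have hvb := L.marked_bounds hc (hr.2.2.1 v hr.2.1 le_rfl)
  -- The trivial arc is the innermost one, so its run is central and the extended component is an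
  -- edge, which has a fixed point.
  have hcen : IsCentralRun l r v := by rw [IsCentralRun]; lia
  obtain ⟨x, hx, hx'⟩ := ((L.isModified.antiToeplitz l r u v hc hr).edge hcen).exists_fixed
    (subLeft_involutive _) L.isModified.involutive
  have hb := L.extended_bounds hc hr hx
  have := hr.1
  refine ⟨l, r, x, hc, by lia, by lia, by lia, ?_⟩
  -- As `l + r` is odd, the reflection itself fixes no integer.
  rcases hx' with h | h
  · rw [Equiv.subLeft_apply] at h
    lia
  · exact h

end Layer

end Biparabolic

namespace Biparabolic

/-! ### Positions of the centres -/

lemma IsHalfArc.mem_Icc {n : ℕ} {Q : Set ℤ} {i j : ℤ} (h : IsHalfArc n Q i j) :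
    i ∈ Set.Icc (1 : ℤ) (n - 1) ∧ j ∈ Set.Icc (1 : ℤ) (n - 1) := by
  obtain ⟨l, r, hc, h₁, h₂, h₃⟩ := h
  have := hc.1
  have := hc.2.2.1
  exact ⟨⟨by lia, by lia⟩, ⟨by lia, by lia⟩⟩

lemma SameHalfMeander.of_arc {n : ℕ} {P : Side → Set ℤ} {s : Side} {i j : ℤ}
    (h : IsHalfArc n (P s) i j) : SameHalfMeander n P i j := .rel _ _ ⟨s, h⟩

section Centres

variable {n : ℕ} {P : Side → Set ℤ} {M : Side → Set (ℤ × ℤ)} {σ : Side → Equiv.Perm ℤ}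

lemma IsMarking.unique (hM : IsMarking n P M) {s s' : Side} {i j i' j' : ℤ} (h : (i, j) ∈ M s)
    (h' : (i', j') ∈ M s') (hs : SameHalfMeander n P i i') : s = s' ∧ i = i' ∧ j = j' := by
  obtain ⟨q, -, hq⟩ := hM.existsUnique i (hM.isHalfArc s i j h).mem_Icc.1
  have h1 := hq (s, i, j) ⟨h, .refl _⟩
  have h2 := hq (s', i', j') ⟨h', hs⟩
  simpa using h1.trans h2.symm

variable {s s' : Side} {l r l' r' a : ℤ}

/-- Otherwise `a` is left of the centre on side `s`, and all arcs of side `s` with left ends from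
`a` inward are marked. The centre on side `s'` falls among these left ends. An integer centre beyond
`a` joins two marked arcs by `(k - 1, k)`; a half-integer one puts a trivial arc on a meander whose
marked arc is not trivial; if `a` is the centre, being moved it yields a second marked arc `(a - 1,
a)`, on side `s'`. -/
lemma centre_le_of_fixed_of_lt (hM : IsMarking n P M) (L : ∀ s, IsLayer n (P s) (M s) (σ s))
    (hss : s ≠ s') (hc : IsComponent n (P s) l r) (hc' : IsComponent n (P s') l' r')
    (h₁ : l ≤ a) (h₂ : a ≤ r) (h₃ : l' ≤ a) (h₄ : a ≤ r') (hfix : σ s a = a) (hlt : a < σ s' a) :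
    l + r ≤ l' + r' := by
  by_contra! hcon
  have hcr := (L s').crosses_centre hc' h₃ h₄ hlt
  have hm : ∀ i, a ≤ i → 2 * i ≤ l + r - 1 → (i, l + r - 1 - i) ∈ M s := fun i hi hi' =>
    (L s).marked_of_fixed hc h₁ h₂ (by lia) hfix (.inl hi) hi'
  obtain ⟨k, hk | hk⟩ := Int.even_or_odd' (l' + r')
  · rcases lt_or_ge a k with hak | hak
    · have := hM.unique (hm (k - 1) (by lia) (by lia)) (hm k (by lia) (by lia))
        (.of_arc (s := s') ⟨l', r', hc', by lia, by lia, by lia⟩)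
      lia
    · obtain rfl : a = k := by lia
      have hmem := (L s').marked_of_centre_moved hc' (by lia) hlt.ne'
      exact hss (hM.unique hmem (hm a le_rfl (by lia)) (.of_arc ((L s').isHalfArc _ _ hmem))).1.symm
  · have := hM.trivial_of_edge s k _ (hm k (by lia) (by lia))
      ⟨s', k, ⟨l', r', hc', by lia, le_rfl, by lia⟩, .refl _⟩
    lia

/-- Mirror image of `centre_le_of_fixed_of_lt`. Uniqueness is stated for left ends, so right ends
near `a` are first carried along their own arcs. -/
lemma centre_le_of_fixed_of_gt (hM : IsMarking n P M) (L : ∀ s, IsLayer n (P s) (M s) (σ s))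
    (hss : s ≠ s') (hc : IsComponent n (P s) l r) (hc' : IsComponent n (P s') l' r')
    (h₁ : l ≤ a) (h₂ : a ≤ r) (h₃ : l' ≤ a) (h₄ : a ≤ r') (hfix : σ s a = a) (hlt : σ s' a < a) :
    l' + r' ≤ l + r := by
  by_contra! hcon
  have hcr := (L s').crosses_centre' hc' h₃ h₄ hlt
  have hm : ∀ j, j < a → l + r - 1 ≤ 2 * j → (l + r - 1 - j, j) ∈ M s := fun j hi hi' => by
    have := (L s).marked_of_fixed hc h₁ h₂ (i := l + r - 1 - j) (by lia) hfix (.inr (by lia))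
      (by lia)
    rw [IsMarkedArc] at this
    convert this using 2; lia
  have hs : ∀ j, j < a → l + r - 1 ≤ 2 * j → SameHalfMeander n P (l + r - 1 - j) j :=
    fun j hi hi' => .of_arc ((L s).isHalfArc _ _ (hm j hi hi'))
  obtain ⟨k, hk | hk⟩ := Int.even_or_odd' (l' + r')
  · rcases lt_or_ge k a with hak | hak
    · have := hM.unique (hm (k - 1) (by lia) (by lia)) (hm k (by lia) (by lia))
        ((hs _ (by lia) (by lia)).trans _ _ _ ((SameHalfMeander.of_arc (s := s')
          ⟨l', r', hc', by lia, by lia, by lia⟩).trans _ _ _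
          ((hs k (by lia) (by lia)).symm _ _)))
      lia
    · obtain rfl : a = k := by lia
      have hmem := (L s').marked_of_centre_moved hc' (by lia) hlt.ne
      exact hss (hM.unique hmem (hm (a - 1) (by lia) (by lia)) ((hs _ (by lia) (by lia)).symm _ _)).1.symm
  · have := hM.trivial_of_edge s _ k (hm k (by lia) (by lia))
      ⟨s', k, ⟨l', r', hc', by lia, le_rfl, by lia⟩, hs k (by lia) (by lia)⟩
    lia

/-- Both arcs cross their centres, which gives the weak inequality. Equality would make `a` a moved
centre on both sides, and `(a - 1, a)` would be marked twice. -/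
lemma centre_lt_of_lt_of_gt (hM : IsMarking n P M) (L : ∀ s, IsLayer n (P s) (M s) (σ s))
    (hss : s ≠ s') (hc : IsComponent n (P s) l r) (hc' : IsComponent n (P s') l' r')
    (h₁ : l ≤ a) (h₂ : a ≤ r) (h₃ : l' ≤ a) (h₄ : a ≤ r') (hgt : σ s a < a) (hlt : a < σ s' a) :
    l + r < l' + r' := by
  have h := (L s).crosses_centre' hc h₁ h₂ hgt
  have h' := (L s').crosses_centre hc' h₃ h₄ hlt
  by_contra hcon
  have hm := (L s).marked_of_centre_moved hc (x := a) (by lia) hgt.ne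
  have hm' := (L s').marked_of_centre_moved hc' (x := a) (by lia) hlt.ne'
  exact hss (hM.unique hm hm' (.refl _)).1

end Centres

end Biparabolic

namespace Biparabolic

/-! ### Parity of involutions -/

lemma sum_one_eq_zero_of_involution {Z : Finset ℤ} (g : ℤ → ℤ) (h₁ : ∀ k ∈ Z, g k ∈ Z)
    (h₂ : ∀ k ∈ Z, g (g k) = k) (h₃ : ∀ k ∈ Z, g k ≠ k) : ∑ _k ∈ Z, (1 : ZMod 2) = 0 :=
  Finset.sum_involution (fun k _ => g k) (fun _ _ => by decide) (fun k hk _ => h₃ k hk)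
    (fun k hk => h₁ k hk) (fun k hk => h₂ k hk)

-- The points of `E` in `Y` that are not fixed pair off under `τ`.
open Classical in
lemma sum_indicator_eq_sum_fixed {τ : Equiv.Perm ℤ} (hτ : Function.Involutive τ) {E : Set ℤ}
    (hE : ∀ x ∈ E, τ x ∈ E) {Y : Finset ℤ} (hY : ∀ x ∈ Y, τ x ∈ Y) :
    ∑ x ∈ Y, (if x ∈ E then (1 : ZMod 2) else 0) =
      ∑ x ∈ Y, if x ∈ E ∧ τ x = x then (1 : ZMod 2) else 0 := by
  have h0 : ∑ _x ∈ Y with _x ∈ E ∧ τ _x ≠ _x, (1 : ZMod 2) = 0 := by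
    refine sum_one_eq_zero_of_involution τ ?_ (fun k _ => hτ k) ?_
    · intro k hk
      rw [Finset.mem_filter] at hk ⊢
      exact ⟨hY k hk.1, hE k hk.2.1, fun h => hk.2.2 (τ.injective h)⟩
    · intro k hk
      exact (Finset.mem_filter.1 hk).2.2
  rw [Finset.sum_filter] at h0
  rw [← sub_eq_zero, ← Finset.sum_sub_distrib]
  refine (Finset.sum_congr rfl fun x _ => ?_).trans h0
  by_cases h : x ∈ E <;> by_cases h' : τ x = x <;> simp [h, h']

/-! ### The partner of a half-integer point -/

open Classical in
/-- The other end of the half-integer arc starting at `k + 1/2`. -/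
noncomputable def partner (n : ℕ) (Q : Set ℤ) (k : ℤ) : ℤ :=
  if h : ∃ c l r, IsComponent n Q l r ∧ l ≤ k ∧ k < r ∧ c = l + r - 1 then h.choose - k else k

lemma partner_eq {n : ℕ} {Q : Set ℤ} {l r k : ℤ} (hc : IsComponent n Q l r) (h₁ : l ≤ k)
    (h₂ : k < r) : partner n Q k = l + r - 1 - k := by
  have h : ∃ c l r, IsComponent n Q l r ∧ l ≤ k ∧ k < r ∧ c = l + r - 1 := ⟨_, l, r, hc, h₁, h₂, rfl⟩
  rw [partner, dif_pos h]
  obtain ⟨l', r', hc', h₃, h₄, h₅⟩ := h.choose_spec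
  obtain ⟨rfl, rfl⟩ := hc.eq_of_mem hc' h₁ h₂.le h₃ h₄.le
  rw [h₅]

lemma exists_component_of_mem {n : ℕ} {Q : Set ℤ} (hQ : Q ⊆ Set.Icc (1 : ℤ) (n - 1)) {k : ℤ}
    (hk : k ∈ Q) : ∃ l r, IsComponent n Q l r ∧ l ≤ k ∧ k < r := by
  obtain ⟨h₁, h₂⟩ := hQ hk
  obtain ⟨l, r, hc, h₃, h₄⟩ := exists_isComponent hQ h₁ (by lia)
  exact ⟨l, r, hc, h₃, lt_of_le_of_ne h₄ fun h => hc.2.2.2.2.2 (h ▸ hk)⟩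

/-- The two ends of a half-integer arc, in increasing order, form an arc. -/
lemma isHalfArc_min_max {n : ℕ} {Q : Set ℤ} {l r k : ℤ} (hc : IsComponent n Q l r) (h₁ : l ≤ k)
    (h₂ : k < r) : IsHalfArc n Q (min k (l + r - 1 - k)) (max k (l + r - 1 - k)) :=
  ⟨l, r, hc, by lia, by lia, by lia⟩

lemma sameHalfMeander_partner {n : ℕ} {P : Side → Set ℤ} {s : Side} {l r k : ℤ}
    (hc : IsComponent n (P s) l r) (h₁ : l ≤ k) (h₂ : k < r) :
    SameHalfMeander n P k (l + r - 1 - k) := by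
  have h := SameHalfMeander.of_arc (isHalfArc_min_max hc h₁ h₂)
  rcases le_total k (l + r - 1 - k) with hle | hle
  · rwa [min_eq_left hle, max_eq_right hle] at h
  · rw [min_eq_right hle, max_eq_left hle] at h
    exact h.symm _ _

/-! ### Sets stable under the modified involutions -/

/-- A set of points stable under both modified involutions, all of whose fixed points lie in two
components with the same centre, one on each side. -/
structure IsConcentric (n : ℕ) (P : Side → Set ℤ) (M : Side → Set (ℤ × ℤ))
    (σ : Side → Equiv.Perm ℤ) (E : Set ℤ) (cl cr : Side → ℤ) (c : ℤ) (p : ZMod 2) : Prop where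
  layer : ∀ s, IsLayer n (P s) (M s) (σ s)
  marking : IsMarking n P M
  subset : E ⊆ Set.Icc (1 : ℤ) n
  stable : ∀ s, ∀ x ∈ E, σ s x ∈ E
  component : ∀ s, IsComponent n (P s) (cl s) (cr s)
  centre : ∀ s, cl s + cr s = c
  fixed : ∀ s, ∀ x ∈ E, σ s x = x → cl s ≤ x ∧ x ≤ cr s
  count : ∀ s, ∀ Y : Finset ℤ, (∀ x ∈ E, σ s x = x → x ∈ Y) →
    (∑ x ∈ Y, open Classical in if x ∈ E ∧ σ s x = x then (1 : ZMod 2) else 0) = p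
  even : p ≠ 0 → Even c

open Classical in
/-- The indicator function of `E`, corrected at the centre. -/
noncomputable def weight (E : Set ℤ) (c : ℤ) (p : ZMod 2) (x : ℤ) : ZMod 2 :=
  (if x ∈ E then 1 else 0) + (if 2 * x = c then p else 0)

/-- Partial sums of `weight`. -/
noncomputable def height (E : Set ℤ) (c : ℤ) (p : ZMod 2) (k : ℤ) : ZMod 2 :=
  ∑ x ∈ Finset.Ioc 0 k, weight E c p x

lemma height_sub {E : Set ℤ} {c : ℤ} {p : ZMod 2} {i j : ℤ} (hi : 0 ≤ i) (hij : i ≤ j) :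
    height E c p j = height E c p i + ∑ x ∈ Finset.Ioc i j, weight E c p x := by
  rw [height, height, ← Finset.sum_union, Finset.Ioc_union_Ioc_eq_Ioc hi hij]
  rw [Finset.disjoint_left]
  intro x hx hx'
  rw [Finset.mem_Ioc] at hx hx'
  lia

/-! ### A stable set with concentric fixed points is `[1, n]`, which is impossible -/

namespace IsConcentric

variable {n : ℕ} {P : Side → Set ℤ} {M : Side → Set (ℤ × ℤ)} {σ : Side → Equiv.Perm ℤ}
  {E : Set ℤ} {cl cr : Side → ℤ} {c : ℤ} {p : ZMod 2} (C : IsConcentric n P M σ E cl cr c p)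

include C

/-- The fixed points contribute `p` and the centre correction a second `p`. A half-integer centre
carries no correction, but then `p = 0`. -/
lemma sum_weight_of_all {s : Side} {Y : Finset ℤ} (hY : ∀ x ∈ Y, σ s x ∈ Y)
    (h₁ : ∀ x ∈ E, σ s x = x → x ∈ Y) (h₂ : ∀ x, 2 * x = c → x ∈ Y) :
    ∑ x ∈ Y, weight E c p x = 0 := by
  classical
  have h := sum_indicator_eq_sum_fixed (C.layer s).isModified.involutive (C.stable s) hY
  have hcount := C.count s Y h₁
  simp only [weight, Finset.sum_add_distrib]
  have hself : p + p = 0 := (by decide : ∀ q : ZMod 2, q + q = 0) p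
  have hc : ∑ x ∈ Y, (if 2 * x = c then p else 0) = p := by
    by_cases hp : p = 0
    · simp [hp]
    · obtain ⟨k, hk⟩ := C.even hp
      rw [Finset.sum_eq_single_of_mem k (h₂ k (by lia)) fun x _ hx => if_neg (by lia), if_pos (by lia)]
  rw [hc]
  convert hself using 2
  rw [← hcount]
  convert h

lemma sum_weight_of_none {s : Side} {Y : Finset ℤ} (hY : ∀ x ∈ Y, σ s x ∈ Y)
    (h₁ : ∀ x ∈ E, σ s x = x → x ∉ Y) (h₂ : ∀ x, 2 * x = c → x ∉ Y) :
    ∑ x ∈ Y, weight E c p x = 0 := by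
  classical
  have h := sum_indicator_eq_sum_fixed (C.layer s).isModified.involutive (C.stable s) hY
  simp only [weight, Finset.sum_add_distrib]
  rw [Finset.sum_eq_zero (f := fun x => if 2 * x = c then p else 0)
    fun x hx => if_neg fun hx' => h₂ x hx' hx, add_zero]
  rw [Finset.sum_eq_zero (f := fun x => if x ∈ E ∧ σ s x = x then (1 : ZMod 2) else 0)
    fun x hx => if_neg fun hx' => h₁ x hx'.1 hx'.2 hx] at h
  convert h

lemma centre_mem (s : Side) {x : ℤ} (hx : 2 * x = c) : cl s ≤ x ∧ x ≤ cr s := by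
  have := C.centre s
  have := (C.component s).2.1
  lia

/-- The points between the two ends form a `σ s`-stable interval. In the central component it
contains the centre and all fixed points of `σ s` in `E`, since arcs inside a fixed point off the
centre are marked; in any other component it contains neither. Its total weight vanishes in both
cases. -/
lemma height_eq_of_unmarked {s : Side} {l r i : ℤ} (hc : IsComponent n (P s) l r)
    (hi : l - 1 ≤ i) (hi' : 2 * i ≤ l + r - 1) (hm : ¬ IsMarkedArc (M s) l r i) :
    height E c p (l + r - 1 - i) = height E c p i := by
  have hl := hc.1
  rw [height_sub (i := i) (j := l + r - 1 - i) (by lia) (by lia)]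
  rcases eq_or_lt_of_le hi' with h | h
  · rw [Finset.Ioc_eq_empty (by lia), Finset.sum_empty, add_zero]
  have hY : ∀ x ∈ Finset.Ioc i (l + r - 1 - i), σ s x ∈ Finset.Ioc i (l + r - 1 - i) := by
    intro x hx
    rw [Finset.mem_Ioc] at hx ⊢
    have := (C.layer s).apply_mem_inner hc hi hm hx.1 (by lia)
    lia
  by_cases hs : l = cl s
  · obtain ⟨-, hr⟩ := hc.eq_of_mem (C.component s) le_rfl hc.2.1 hs.symm.le
      (hs ▸ (C.component s).2.1)
    have hcen := C.centre s
    rw [C.sum_weight_of_all hY, add_zero]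
    · intro x hx hfix
      have hb := C.fixed s x hx hfix
      rw [Finset.mem_Ioc]
      by_contra hcon
      exact hm ((C.layer s).marked_of_fixed hc (by lia) (by lia) (by lia) hfix (by lia) (by lia))
    · intro x hx
      rw [Finset.mem_Ioc]
      lia
  · have hdis : ∀ x, cl s ≤ x → x ≤ cr s → x ∉ Finset.Ioc i (l + r - 1 - i) := by
      intro x h₁ h₂ hx
      rw [Finset.mem_Ioc] at hx
      exact hs (hc.eq_of_mem (C.component s) (x := x) (by lia) (by lia) h₁ h₂).1
    rw [C.sum_weight_of_none hY, add_zero]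
    · intro x hx hfix
      exact hdis x (C.fixed s x hx hfix).1 (C.fixed s x hx hfix).2
    · intro x hx
      exact hdis x (C.centre_mem s hx).1 (C.centre_mem s hx).2

/-- No interval of side `s` straddles `k`, so `[1, k]` is stable and contains the central component
entirely or misses it. -/
lemma height_eq_zero {s : Side} {k : ℤ} (hk : k ≤ n) (hkP : k ∉ P s) : height E c p k = 0 := by
  have hY : ∀ x ∈ Finset.Ioc 0 k, σ s x ∈ Finset.Ioc 0 k := by
    intro x hx
    rw [Finset.mem_Ioc] at hx ⊢
    obtain ⟨l, r, hc, h₁, h₂⟩ := exists_isComponent (C.layer s).subset (x := x) (by lia) (by lia)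
    have hr : r ≤ k := by
      by_contra hcon
      exact hkP (hc.2.2.2.1 k (by lia) (by lia))
    have := (C.layer s).apply_mem hc h₁ h₂
    have := hc.1
    lia
  have hcomp := C.component s
  have h1 := hcomp.1
  rcases lt_or_ge k (cl s) with h | h
  · refine C.sum_weight_of_none hY ?_ ?_
    · intro x hx hfix
      have := C.fixed s x hx hfix
      rw [Finset.mem_Ioc]; lia
    · intro x hx
      have := C.centre_mem s hx
      rw [Finset.mem_Ioc]; lia
  · have hr : cr s ≤ k := by
      by_contra hcon
      exact hkP (hcomp.2.2.2.1 k h (by lia))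
    refine C.sum_weight_of_all hY ?_ ?_
    · intro x hx hfix
      have := C.fixed s x hx hfix
      rw [Finset.mem_Ioc]; lia
    · intro x hx
      have := C.centre_mem s hx
      rw [Finset.mem_Ioc]; lia

lemma height_partner {s : Side} {l r k : ℤ} (hc : IsComponent n (P s) l r) (h₁ : l ≤ k)
    (h₂ : k < r) (hm : (min k (l + r - 1 - k), max k (l + r - 1 - k)) ∉ M s) :
    height E c p (l + r - 1 - k) = height E c p k := by
  rcases le_total k (l + r - 1 - k) with hle | hle
  · rw [min_eq_left hle, max_eq_right hle] at hm
    exact C.height_eq_of_unmarked hc (by lia) (by lia) hm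
  · rw [min_eq_right hle, max_eq_left hle] at hm
    have := C.height_eq_of_unmarked hc (i := l + r - 1 - k) (by lia) (by lia)
      (by rw [IsMarkedArc]; convert hm using 3; lia)
    rw [← this]
    congr 1; lia

/-- The two ends of a marked arc cannot be told apart by the height. -/
lemma not_height_marked {s : Side} {i j q q' : ℤ} (hij : (i, j) ∈ M s) (hne : i ≠ j)
    (hq : (q = i ∧ q' = j) ∨ (q = j ∧ q' = i)) (h₁ : height E c p q = 1)
    (h₀ : height E c p q' = 0) : False := by
  classical
  have harc := (C.layer s).isHalfArc _ _ hij
  obtain ⟨l₀, r₀, hc₀, hi₁, hi₂, hi₃⟩ := id harc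
  -- The points of height 1 on the meander. Unmarked arcs pair them; only the marked arc leaves `Z`,
  -- from `q` to `q'`.
  set Z : Finset ℤ := (Finset.Icc 1 ((n : ℤ) - 1)).filter
    fun k => SameHalfMeander n P i k ∧ height E c p k = 1 with hZ
  have memZ : ∀ k, k ∈ Z ↔ k ∈ Finset.Icc 1 ((n : ℤ) - 1) ∧ SameHalfMeander n P i k ∧
      height E c p k = 1 := fun k => by rw [hZ, Finset.mem_filter]
  have step : ∀ t, ∀ k ∈ Z, (t = s → k ≠ q) → ∃ l r, IsComponent n (P t) l r ∧ l ≤ k ∧ k < r ∧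
      partner n (P t) k = l + r - 1 - k ∧ l + r - 1 - k ≠ k ∧ l + r - 1 - k ∈ Z ∧
      (t = s → l + r - 1 - k ≠ q) := by
    intro t k hk hkq
    obtain ⟨hk₁, hk₂, hk₃⟩ := (memZ k).1 hk
    rw [Finset.mem_Icc] at hk₁
    -- The meander cannot stop inside `Z`: where side `t` has no arc, the height is zero.
    have hkP : k ∈ P t := by
      by_contra h
      rw [C.height_eq_zero (by lia) h] at hk₃
      exact zero_ne_one hk₃
    obtain ⟨l, r, hc, h₂, h₃⟩ := exists_component_of_mem (C.layer t).subset hkP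
    have hsame := hk₂.trans _ _ _ (sameHalfMeander_partner hc h₂ h₃)
    have hnot : ∀ x y, ((x = k ∧ y = l + r - 1 - k) ∨ (y = k ∧ x = l + r - 1 - k)) →
        (x, y) ∈ M t → False := by
      intro x y hxy hmem
      have hx : SameHalfMeander n P i x := by
        rcases hxy with h | h
        · rw [h.1]; exact hk₂
        · rw [h.2]; exact hsame
      obtain ⟨rfl, rfl, rfl⟩ := C.marking.unique hij hmem hx
      have hkq' := hkq rfl
      have : k = q' := by lia
      rw [this, h₀] at hk₃
      exact zero_ne_one hk₃
    have hheight : height E c p (l + r - 1 - k) = 1 := by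
      rw [C.height_partner hc h₂ h₃ fun h => hnot _ _ (by lia) h, hk₃]
    have hh := (isHalfArc_min_max hc h₂ h₃).mem_Icc
    refine ⟨l, r, hc, h₂, h₃, partner_eq hc h₂ h₃, ?_, ?_, ?_⟩
    -- A trivial arc on the meander would force the marked arc to be trivial.
    · intro h
      exact hne (C.marking.trivial_of_edge s i j hij
        ⟨t, k, ⟨l, r, hc, h₂, le_rfl, by lia⟩, hk₂⟩)
    · rw [memZ, Finset.mem_Icc]
      refine ⟨?_, hsame, hheight⟩
      have h1 := hh.1.1
      have h2 := hh.2.2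
      lia
    · rintro rfl hkq'
      have : l = l₀ ∧ r = r₀ := hc.eq_of_mem hc₀ (x := q) (by lia) (by lia) (by lia) (by lia)
      have hkq'' : k = q' := by lia
      rw [hkq'', h₀] at hk₃
      exact zero_ne_one hk₃
  have hinv : ∀ t, ∀ k ∈ Z, (t = s → k ≠ q) → partner n (P t) (partner n (P t) k) = k := by
    intro t k hk hkq
    obtain ⟨l, r, hc, h₂, h₃, h₄, -⟩ := step t k hk hkq
    rw [h₄, partner_eq hc (by lia) (by lia)]
    lia
  obtain ⟨t, ht⟩ : ∃ t : Side, t ≠ s := by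
    cases s
    exacts [⟨.below, by simp⟩, ⟨.above, by simp⟩]
  -- The partner map on the other side shows that `Z` has even size; the one on the marked side
  -- shows the same for `Z` without `q`.
  have hA : ∑ _k ∈ Z, (1 : ZMod 2) = 0 := by
    refine sum_one_eq_zero_of_involution (partner n (P t)) ?_ ?_ ?_
    · intro k hk
      obtain ⟨l, r, -, -, -, h₄, -, h₆, -⟩ := step t k hk fun h => absurd h ht
      rwa [h₄]
    · exact fun k hk => hinv t k hk fun h => absurd h ht
    · intro k hk
      obtain ⟨l, r, -, -, -, h₄, h₅, -⟩ := step t k hk fun h => absurd h ht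
      rwa [h₄]
  have hB : ∑ _k ∈ Z.erase q, (1 : ZMod 2) = 0 := by
    refine sum_one_eq_zero_of_involution (partner n (P s)) ?_ ?_ ?_
    · intro k hk
      rw [Finset.mem_erase] at hk ⊢
      obtain ⟨l, r, -, -, -, h₄, -, h₆, h₇⟩ := step s k hk.2 fun _ => hk.1
      rw [h₄]
      exact ⟨h₇ rfl, h₆⟩
    · intro k hk
      rw [Finset.mem_erase] at hk
      exact hinv s k hk.2 fun _ => hk.1
    · intro k hk
      rw [Finset.mem_erase] at hk
      obtain ⟨l, r, -, -, -, h₄, h₅, -⟩ := step s k hk.2 fun _ => hk.1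
      rwa [h₄]
  have hqZ : q ∈ Z := by
    rw [memZ, Finset.mem_Icc]
    have hh := harc.mem_Icc
    refine ⟨?_, ?_, h₁⟩
    · rcases hq with ⟨rfl, -⟩ | ⟨rfl, -⟩
      exacts [hh.1, hh.2]
    · rcases hq with ⟨rfl, -⟩ | ⟨rfl, -⟩
      exacts [.refl _, .of_arc harc]
  rw [← Finset.add_sum_erase Z _ hqZ, hB] at hA
  exact absurd hA (by decide)

lemma height_eq {s : Side} {l r i : ℤ} (hc : IsComponent n (P s) l r)
    (hi : l - 1 ≤ i) (hi' : 2 * i ≤ l + r - 1) :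
    height E c p (l + r - 1 - i) = height E c p i := by
  by_cases hm : IsMarkedArc (M s) l r i
  · rcases eq_or_ne i (l + r - 1 - i) with h | h
    · rw [← h]
    · have hz : ∀ z : ZMod 2, z = 0 ∨ z = 1 := by decide
      rcases hz (height E c p i) with h₀ | h₀ <;> rcases hz (height E c p (l + r - 1 - i)) with h₁ | h₁
      · rw [h₀, h₁]
      · exact (C.not_height_marked hm h (.inr ⟨rfl, rfl⟩) h₁ h₀).elim
      · exact (C.not_height_marked hm h (.inl ⟨rfl, rfl⟩) h₀ h₁).elim
      · rw [h₀, h₁]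
  · exact C.height_eq_of_unmarked hc hi hi' hm

/-- Two consecutive half-integer arcs enclose `x` and its mirror image. Equal heights at the ends of
both arcs make the increments at the two points equal, and neither of them is the corrected centre.
-/
lemma mem_of_reflect_lt {s : Side} {l r x : ℤ} (hc : IsComponent n (P s) l r) (hx : l ≤ x)
    (hx' : 2 * x < l + r) : x ∈ E ↔ l + r - x ∈ E := by
  classical
  have hl := hc.1
  have h₁ := C.height_eq hc (i := x - 1) (by lia) (by lia)
  have h₂ := C.height_eq hc (i := x) (by lia) (by lia)
  have h₃ := height_sub (E := E) (c := c) (p := p) (i := x - 1) (j := x) (by lia) (by lia)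
  have h₄ := height_sub (E := E) (c := c) (p := p) (i := l + r - 1 - x) (j := l + r - x)
    (by lia) (by lia)
  have hI : ∀ y : ℤ, Finset.Ioc (y - 1) y = {y} := fun y => by
    ext z; rw [Finset.mem_Ioc, Finset.mem_singleton]; lia
  rw [hI, Finset.sum_singleton] at h₃
  rw [show l + r - 1 - x = l + r - x - 1 by ring, hI, Finset.sum_singleton] at h₄
  rw [show l + r - 1 - (x - 1) = l + r - x by ring] at h₁
  rw [show l + r - 1 - x = l + r - x - 1 by ring] at h₂
  rw [h₁, h₂, h₃] at h₄
  have hw : weight E c p x = weight E c p (l + r - x) := by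
    have key : ∀ a b d : ZMod 2, a = a + b + d → b = d := by decide
    exact key _ _ _ h₄
  have hne : ∀ y, l ≤ y → y ≤ r → 2 * y ≠ l + r → 2 * y ≠ c := by
    intro y h₅ h₆ h₇ h₈
    have hm := C.centre_mem s h₈
    obtain ⟨rfl, rfl⟩ := hc.eq_of_mem (C.component s) h₅ h₆ hm.1 hm.2
    exact h₇ (h₈.trans (C.centre s).symm)
  rw [weight, weight, if_neg (hne x hx (by lia) (by lia)),
    if_neg (hne (l + r - x) (by lia) (by lia) (by lia)), add_zero, add_zero] at hw
  by_cases hxE : x ∈ E <;> by_cases hyE : l + r - x ∈ E <;> simp [hxE, hyE] at hw ⊢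

lemma mem_reflect {s : Side} {l r x : ℤ} (hc : IsComponent n (P s) l r) (hx : l ≤ x)
    (hx' : x ≤ r) : x ∈ E ↔ l + r - x ∈ E := by
  rcases lt_trichotomy (2 * x) (l + r) with h | h | h
  · exact C.mem_of_reflect_lt hc hx h
  · rw [show l + r - x = x by lia]
  · rw [C.mem_of_reflect_lt hc (x := l + r - x) (by lia) (by lia), sub_sub_cancel]

/-- For a trivial arc the reflection swaps `i` and `i + 1`. Otherwise both lie in one extended
component, a single orbit under two involutions preserving `E` inside `[l, r]`. -/
lemma mem_succ_of_marked {s : Side} {i j : ℤ} (h : (i, j) ∈ M s) : i ∈ E ↔ i + 1 ∈ E := by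
  obtain ⟨l, r, hc, h₁, h₂, h₃⟩ := (C.layer s).isHalfArc _ _ h
  have hm : IsMarkedArc (M s) l r i := by rw [IsMarkedArc]; convert h using 2; lia
  rcases eq_or_lt_of_le h₂ with rfl | hlt
  · rw [C.mem_reflect hc h₁ (by lia), show l + r - i = i + 1 by lia]
  · obtain ⟨u, v, hr, hu, hv⟩ := (C.layer s).exists_run hc hm
    have hX : i ∈ extendedComponent l r u v := by
      rw [mem_extended, (C.layer s).mem_leftHalf hc hr]; lia
    have hX' : i + 1 ∈ extendedComponent l r u v := by
      rw [mem_extended, (C.layer s).mem_leftHalf hc hr]; lia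
    have hA₁ : ∀ x ∈ E ∩ Set.Icc l r, l + r - x ∈ E ∩ Set.Icc l r := fun x hx =>
      ⟨(C.mem_reflect hc hx.2.1 hx.2.2).1 hx.1, by have := hx.2.2; lia, by have := hx.2.1; lia⟩
    have hA₂ : ∀ x ∈ E ∩ Set.Icc l r, σ s x ∈ E ∩ Set.Icc l r := fun x hx =>
      ⟨C.stable s x hx.1, (C.layer s).apply_mem hc hx.2.1 hx.2.2⟩
    constructor
    · intro hi
      exact ((C.layer s).extended_subset hc hr hA₁ hA₂ hX ⟨hi, h₁, by lia⟩ hX').1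
    · intro hi
      exact ((C.layer s).extended_subset hc hr hA₁ hA₂ hX' ⟨hi, by lia, by lia⟩ hX).1

/-- The reflection carries the pair `i, i + 1` to `j + 1, j`. -/
lemma mem_succ_iff_of_sameHalfMeander {i j : ℤ} (h : SameHalfMeander n P i j) :
    (i ∈ E ↔ i + 1 ∈ E) ↔ (j ∈ E ↔ j + 1 ∈ E) := by
  induction h with
  | rel i j h =>
    obtain ⟨s, l, r, hc, h₁, h₂, h₃⟩ := h
    rw [C.mem_reflect hc h₁ (by lia), C.mem_reflect hc (x := i + 1) (by lia) (by lia),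
      show l + r - i = j + 1 by lia, show l + r - (i + 1) = j by lia]
    tauto
  | refl => rfl
  | symm _ _ _ ih => exact ih.symm
  | trans _ _ _ _ _ ih ih' => exact ih.trans ih'

/-- Every half-integer point shares its meander with a marked arc, so membership passes from each
point to the next. -/
lemma eq_Icc (hne : E.Nonempty) : E = Set.Icc (1 : ℤ) n := by
  have hsucc : ∀ k ∈ Set.Icc (1 : ℤ) (n - 1), (k ∈ E ↔ k + 1 ∈ E) := by
    intro k hk
    obtain ⟨⟨s, i, j⟩, ⟨h₁, h₂⟩, -⟩ := C.marking.existsUnique k hk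
    exact (C.mem_succ_iff_of_sameHalfMeander h₂).2 (C.mem_succ_of_marked h₁)
  have hall : ∀ m : ℤ, 1 ≤ m → m ≤ n → (m ∈ E ↔ 1 ∈ E) := by
    intro m hm
    induction m, hm using Int.leInduction with
    | base => simp
    | succ m hm ih =>
      intro hmn
      rw [← hsucc m ⟨hm, by lia⟩]
      exact ih (by lia)
  obtain ⟨x, hx⟩ := hne
  have h1 : (1 : ℤ) ∈ E := (hall x (C.subset hx).1 (C.subset hx).2).1 hx
  exact Set.Subset.antisymm C.subset fun m hm => (hall m hm.1 hm.2).2 h1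

/-- The common central half-integer point has a trivial arc on both sides, so it is a meander by
itself. -/
lemma eq_of_sameHalfMeander_centre {i j : ℤ} (hi : 2 * i + 1 = c) (h : SameHalfMeander n P i j) :
    j = i := by
  have key : ∀ a b, SameHalfMeander n P a b → (a = i ↔ b = i) := by
    intro a b hab
    induction hab with
    | rel a b h =>
      obtain ⟨s, l, r, hc, h₁, h₂, h₃⟩ := h
      have hcen := C.centre s
      have hle := (C.component s).2.1
      constructor
      · rintro rfl
        have := hc.eq_of_mem (C.component s) h₁ (by lia) (by lia) (by lia)
        lia
      · rintro rfl
        have := hc.eq_of_mem (C.component s) (x := b) (by lia) (by lia) (by lia) (by lia)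
        lia
    | refl => rfl
    | symm _ _ _ ih => exact ih.symm
    | trans _ _ _ _ _ ih ih' => exact ih.trans ih'
  exact (key i j h).1 rfl

/-- The interval of side `s` just left of the central one has no fixed points, hence even size and a
trivial half-integer arc at its middle. The marked arc of that meander is trivial and yields a fixed
point, which must lie in a central interval. So the meander is the central half-integer point alone,
and the adjacent interval would be concentric with the central one. -/
lemma false_of_lt (hne : E.Nonempty) {s s' : Side} (hlt : cl s' < cl s) : False := by
  have hE := C.eq_Icc hne
  have hc1 := (C.component s').1
  have hcs := C.component s
  obtain ⟨l, r, hc, h₁, h₂⟩ := exists_isComponent (C.layer s).subset (x := cl s - 1) (by lia)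
    (by have := hcs.2.1; have := hcs.2.2.1; lia)
  have hr : r = cl s - 1 := by
    by_contra hcon
    exact hcs.2.2.2.2.1 (hc.2.2.2.1 _ h₁ (by lia))
  have hl1 := hc.1
  have hrn := hc.2.2.1
  have hsum : ∑ _k ∈ Finset.Icc l r, (1 : ZMod 2) = 0 := by
    refine sum_one_eq_zero_of_involution (σ s) ?_ (fun k _ => (C.layer s).isModified.involutive k) ?_
    · intro k hk
      rw [Finset.mem_Icc] at hk ⊢
      exact (C.layer s).apply_mem hc hk.1 hk.2
    · intro k hk hfix
      rw [Finset.mem_Icc] at hk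
      have := C.fixed s k (by rw [hE]; exact ⟨by lia, by lia⟩) hfix
      lia
  rw [Finset.sum_const, nsmul_eq_mul, mul_one, ZMod.natCast_eq_zero_iff_even, Int.card_Icc] at hsum
  obtain ⟨m, hm⟩ := hsum
  obtain ⟨k, hk⟩ : ∃ k, 2 * k + 1 = l + r := ⟨l + m - 1, by lia⟩
  have harc : IsHalfArc n (P s) k k := ⟨l, r, hc, by lia, le_rfl, by lia⟩
  obtain ⟨⟨t, i, j⟩, ⟨hq₁, hq₂⟩, -⟩ := C.marking.existsUnique k harc.mem_Icc.1
  obtain rfl : i = j := C.marking.trivial_of_edge t i j hq₁ ⟨s, k, harc, hq₂.symm _ _⟩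
  obtain ⟨l', r', x, hc', hi, hx₁, hx₂, hfix⟩ := (C.layer t).exists_fixed_of_marked_trivial hq₁
  have hl1' := hc'.1
  have hrn' := hc'.2.2.1
  have hx := C.fixed t x (by rw [hE]; exact ⟨by lia, by lia⟩) hfix
  obtain ⟨rfl, rfl⟩ := hc'.eq_of_mem (C.component t) hx₁ hx₂ hx.1 hx.2
  have hki := C.eq_of_sameHalfMeander_centre (hi.trans (C.centre t)) (hq₂.symm _ _)
  have := hc.eq_of_add_eq hcs (by rw [C.centre s, ← C.centre t]; lia)
  lia

lemma false (hP : P .above ∪ P .below = Set.Icc (1 : ℤ) (n - 1))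
    (hP' : P .above ∩ P .below ≠ Set.Icc (1 : ℤ) (n - 1)) (hne : E.Nonempty) : False := by
  rcases lt_trichotomy (cl .above) (cl .below) with h | h | h
  · exact C.false_of_lt hne h
  · have ha := C.component .above
    have hb := C.component .below
    have hca := C.centre .above
    have hcb := C.centre .below
    -- Both intervals now coincide, so their boundary labels are missing from `π⁺ ∪ π⁻ = π`; the
    -- interval is `[1, n]` on both sides.
    have hl : cl .above - 1 ∉ Set.Icc (1 : ℤ) (n - 1) := by
      rw [← hP]
      rintro (h' | h')
      · exact ha.2.2.2.2.1 h'
      · exact hb.2.2.2.2.1 (h ▸ h')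
    have hr : cr .above ∉ Set.Icc (1 : ℤ) (n - 1) := by
      rw [← hP]
      rintro (h' | h')
      · exact ha.2.2.2.2.2 h'
      · exact hb.2.2.2.2.2 ((show cr .above = cr .below by lia) ▸ h')
    rw [Set.mem_Icc] at hl hr
    have h1 := ha.1
    have h2 := ha.2.1
    have h3 := ha.2.2.1
    refine hP' (Set.Subset.antisymm (fun x hx => (C.layer .above).subset hx.1) fun x hx => ?_)
    have := hx.1
    have := hx.2
    exact ⟨ha.2.2.2.1 x (by lia) (by lia), hb.2.2.2.1 x (by lia) (by lia)⟩
  · exact C.false_of_lt hne h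

end IsConcentric

end Biparabolic

namespace Biparabolic

/-! ### Consecutive entries of a list -/

/-- The set of pairs of consecutive entries of a list. -/
def listArcs {α : Type*} : List α → Set (α × α)
  | a :: b :: l => insert (a, b) (listArcs (b :: l))
  | _ => ∅

section ListArcs

variable {α : Type*}

@[simp] lemma listArcs_cons_cons (a b : α) (l : List α) :
    listArcs (a :: b :: l) = insert (a, b) (listArcs (b :: l)) := rfl

@[simp] lemma listArcs_singleton (a : α) : listArcs [a] = ∅ := rfl

lemma listArcs_append (l₁ l₂ : List α) (x y : α) :
    listArcs (l₁ ++ x :: y :: l₂) = listArcs (l₁ ++ [x]) ∪ insert (x, y) (listArcs (y :: l₂)) := by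
  induction l₁ with
  | nil => simp
  | cons a l₁ ih =>
    cases l₁ with
    | nil => simp [Set.insert_comm]
    | cons b l₁ =>
      simp only [List.cons_append, listArcs_cons_cons] at ih ⊢
      rw [ih, Set.insert_union]

lemma listArcs_reverse (l : List α) : listArcs l.reverse = Prod.swap ⁻¹' listArcs l := by
  induction l with
  | nil => rfl
  | cons a l ih =>
    cases l with
    | nil => rfl
    | cons b l =>
      rw [List.reverse_cons, List.reverse_cons, List.append_assoc, List.singleton_append,
        listArcs_append, ← List.reverse_cons, ih]
      ext ⟨x, y⟩
      simp only [listArcs_singleton, Set.mem_union, Set.mem_insert_iff, Set.mem_preimage,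
        Prod.swap_prod_mk, listArcs_cons_cons, Prod.mk.injEq, Set.mem_empty_iff_false, or_false]
      tauto

lemma mem_of_mem_listArcs {l : List α} {q : α × α} (h : q ∈ listArcs l) : q.1 ∈ l ∧ q.2 ∈ l := by
  induction l with
  | nil => exact h.elim
  | cons a l ih =>
    cases l with
    | nil => exact h.elim
    | cons b l =>
      rw [listArcs_cons_cons, Set.mem_insert_iff] at h
      rcases h with rfl | h
      · simp
      · have := ih h
        exact ⟨List.mem_cons_of_mem _ this.1, List.mem_cons_of_mem _ this.2⟩

lemma exists_split_of_mem_listArcs {l : List α} {q : α × α} (h : q ∈ listArcs l) :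
    ∃ l₁ l₂, l = l₁ ++ q.1 :: q.2 :: l₂ := by
  induction l with
  | nil => exact h.elim
  | cons a l ih =>
    cases l with
    | nil => exact h.elim
    | cons b l =>
      rw [listArcs_cons_cons, Set.mem_insert_iff] at h
      rcases h with rfl | h
      · exact ⟨[], l, rfl⟩
      · obtain ⟨l₁, l₂, h'⟩ := ih h
        exact ⟨a :: l₁, l₂, by rw [h']; rfl⟩

lemma mem_listArcs_iff_getElem {l : List α} {q : α × α} :
    q ∈ listArcs l ↔ ∃ (i : ℕ) (h : i + 1 < l.length), q = (l[i], l[i + 1]) := by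
  induction l with
  | nil => simp [listArcs]
  | cons a l ih =>
    cases l with
    | nil => simp
    | cons b l =>
      rw [listArcs_cons_cons, Set.mem_insert_iff, ih]
      constructor
      · rintro (rfl | ⟨i, h, rfl⟩)
        · exact ⟨0, by simp, rfl⟩
        · exact ⟨i + 1, by simpa using h, rfl⟩
      · rintro ⟨i, h, rfl⟩
        cases i with
        | zero => exact .inl rfl
        | succ i => exact .inr ⟨i, by simpa using h, rfl⟩

lemma mem_listArcs_range' {s k x y : ℕ} :
    (x, y) ∈ listArcs (List.range' s k) ↔ s ≤ x ∧ y = x + 1 ∧ y < s + k := by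
  induction k generalizing s with
  | zero =>
    simp only [List.range'_zero, listArcs, Set.mem_empty_iff_false]
    lia
  | succ k ih =>
    cases k with
    | zero =>
      simp only [zero_add, List.range'_one, listArcs_singleton, Set.mem_empty_iff_false]
      lia
    | succ k =>
      rw [List.range'_succ, List.range'_succ, listArcs_cons_cons, ← List.range'_succ,
        Set.mem_insert_iff, ih, Prod.mk.injEq]
      lia

end ListArcs

/-! ### Straightening, in terms of indices -/

section Straighten

variable (e : ℕ) (d neg : ℕ → Prop)

/-- The arcs at the internal index `t` do not have the same direction along the edge. -/
def Turn (t : ℕ) : Prop := 1 < t ∧ t < e ∧ ¬ (d (t - 1) ↔ d t)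

/-- The arcs at the turning index `t` all depart from it. -/
def Src (t : ℕ) : Prop :=
  (t = 1 ∨ t = e ∨ Turn e d t) ∧ (t < e → d t) ∧ (1 < t → ¬ d (t - 1))

/-- The arcs at the turning index `t` all arrive at it. -/
def Snk (t : ℕ) : Prop := Src e (fun i => ¬ d i) t

/-- The arc of index `i` is deleted because of a turning index less than `m`. -/
def Deleted (m i : ℕ) : Prop :=
  ∃ t, Turn e d t ∧ t < m ∧ ((¬ neg t ∧ i + 1 = t) ∨ (neg t ∧ i = t))

/-- The directed arcs of index less than `m` that are not deleted. -/
def keptArcs (m : ℕ) : Set (ℕ × ℕ) :=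
  {q | ∃ i, 1 ≤ i ∧ i < m ∧ ¬ Deleted e d neg m i ∧
    ((d i ∧ q = (i, i + 1)) ∨ (¬ d i ∧ q = (i + 1, i)))}

/-- The candidates for the first turning index of type `opp` after the last negative turning index
`r < t` of type `same`. -/
def headSet (same opp : ℕ → Prop) (t : ℕ) : Set ℕ :=
  {s | opp s ∧ ∀ r < t, Turn e d r → same r → neg r → r < s}

/-- The index crossed by the external arc assigned to `t`. -/
def IndexCross (same opp : ℕ → Prop) (t s : ℕ) : Prop :=
  (¬ neg t ∧ IsLeast {s | opp s ∧ t < s} s) ∨ (neg t ∧ IsLeast (headSet e d neg same opp t) s)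

/-- The external arc `q` is assigned to the turning index `t`. -/
def IsExternal (t : ℕ) (q : ℕ × ℕ) : Prop :=
  ∃ s z, ((¬ neg t ∧ z + 1 = t) ∨ (neg t ∧ z = t + 1)) ∧
    ((Src e d t ∧ IndexCross e d neg (Src e d) (Snk e d) t s ∧ q = (s, z)) ∨
      (Snk e d t ∧ IndexCross e d neg (Snk e d) (Src e d) t s ∧ q = (z, s)))

/-- The list `l` describes the straightening of the part `[1, m]` of the edge. -/
structure IsStraightening (m : ℕ) (l : List ℕ) : Prop where
  nodup : l.Nodup
  mem : ∀ x, x ∈ l ↔ 1 ≤ x ∧ x ≤ m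
  arcs : ∀ q, q ∈ listArcs l ↔ q ∈ keptArcs e d neg m ∨ ∃ t, Turn e d t ∧ t < m ∧ IsExternal e d neg t q
  head : ∃ h l', l = h :: l' ∧ IsLeast (headSet e d neg (Snk e d) (Src e d) m) h
  last : ∃ h l', l = l' ++ [h] ∧ IsLeast (headSet e d neg (Src e d) (Snk e d) m) h

variable {e d neg}

lemma turn_not (t : ℕ) : Turn e (fun i => ¬ d i) t ↔ Turn e d t := by
  simp only [Turn, not_iff_not]

lemma snk_not (t : ℕ) : Snk e (fun i => ¬ d i) t ↔ Src e d t := by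
  simp only [Snk, Src, Turn, not_not]

lemma not_src_of_snk {t : ℕ} (he : 1 < e) (h : Snk e d t) (h' : Src e d t) : False := by
  have h1 := h.2
  have h2 := h'.2
  rcases lt_or_ge t e with ht | ht
  · exact h1.1 ht (h2.1 ht)
  · exact h1.2 (by lia) (h2.2 (by lia))

lemma headSet_not (same opp : ℕ → Prop) (m : ℕ) :
    headSet e (fun i => ¬ d i) neg same opp m = headSet e d neg same opp m := by
  simp only [headSet, turn_not]

lemma isExternal_not (t : ℕ) (q : ℕ × ℕ) :
    IsExternal e (fun i => ¬ d i) neg t q ↔ IsExternal e d neg t q.swap := by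
  have h₁ : Snk e (fun i => ¬ d i) = Src e d := funext fun t => propext (snk_not t)
  have h₂ : Src e (fun i => ¬ d i) = Snk e d := rfl
  obtain ⟨x, y⟩ := q
  simp only [IsExternal, IndexCross, headSet_not, h₁, h₂, Prod.swap_prod_mk, Prod.mk.injEq]
  refine exists_congr fun s => exists_congr fun z => and_congr_right fun _ => ?_
  rw [or_comm, and_comm (a := x = z), and_comm (a := x = s)]

lemma mem_keptArcs_not (m : ℕ) (q : ℕ × ℕ) :
    q ∈ keptArcs e (fun i => ¬ d i) neg m ↔ q.swap ∈ keptArcs e d neg m := by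
  obtain ⟨x, y⟩ := q
  simp only [keptArcs, Deleted, turn_not, Set.mem_ofPred_eq, Prod.swap_prod_mk, Prod.mk.injEq, not_not]
  refine exists_congr fun i => and_congr_right fun _ => and_congr_right fun _ =>
    and_congr_right fun _ => ?_
  rw [or_comm, and_comm (a := x = i + 1), and_comm (a := x = i)]

/-- Reversing all arrows exchanges sources and sinks, so only the extension beyond a sink needs
treatment. -/
lemma IsStraightening.reverse {m : ℕ} {l : List ℕ} (h : IsStraightening e d neg m l) :
    IsStraightening e (fun i => ¬ d i) neg m l.reverse where
  nodup := List.nodup_reverse.2 h.nodup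
  mem x := by rw [List.mem_reverse, h.mem]
  arcs q := by
    rw [listArcs_reverse, Set.mem_preimage, h.arcs, mem_keptArcs_not]
    simp only [turn_not, isExternal_not]
  head := by
    obtain ⟨k, l', rfl, hk⟩ := h.last
    refine ⟨k, l'.reverse, by simp, ?_⟩
    rw [headSet_not, show Snk e (fun i => ¬ d i) = Src e d from funext fun t => propext (snk_not t)]
    exact hk
  last := by
    obtain ⟨k, l', rfl, hk⟩ := h.head
    refine ⟨k, l'.reverse, by simp, ?_⟩
    rw [headSet_not, show Snk e (fun i => ¬ d i) = Src e d from funext fun t => propext (snk_not t)]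
    exact hk

lemma same_direction {t m : ℕ} (hm : m ≤ e) (ht : 1 ≤ t) (hno : ∀ x, t < x → x < m → ¬ Turn e d x) :
    ∀ i, t ≤ i → i < m → (d i ↔ d t) := by
  intro i hi
  induction i, hi using Nat.le_induction with
  | base => exact fun _ => Iff.rfl
  | succ i hi ih =>
    intro him
    rw [← ih (by lia)]
    by_contra hcon
    exact hno (i + 1) (by lia) him ⟨by lia, by lia, fun h => hcon (by simpa using h.symm)⟩

/-- Up to the first internal turning index nothing is deleted and all arcs agree in direction: `1`
is the source and `m` the sink. -/
lemma isStraightening_base {m : ℕ} (he : 1 < e) (hm : 1 < m) (hme : m ≤ e)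
    (hmt : m = e ∨ Turn e d m) (hno : ∀ x, 1 < x → x < m → ¬ Turn e d x) (hd : d 1) :
    IsStraightening e d neg m (List.range' 1 m) where
  nodup := List.nodup_range'
  mem x := by rw [List.mem_range'_1]; lia
  arcs q := by
    have hdir := same_direction hme le_rfl hno
    obtain ⟨x, y⟩ := q
    rw [mem_listArcs_range']
    constructor
    · rintro ⟨h₁, rfl, h₃⟩
      refine .inl ⟨x, h₁, by lia, ?_, .inl ⟨(hdir x h₁ (by lia)).2 hd, rfl⟩⟩
      rintro ⟨t, ht, ht', -⟩
      exact hno t ht.1 ht' ht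
    · rintro (⟨i, h₁, h₂, -, ⟨-, h⟩ | ⟨h, -⟩⟩ | ⟨t, ht, ht', -⟩)
      · rw [Prod.mk.injEq] at h
        lia
      · exact absurd ((hdir i h₁ h₂).2 hd) h
      · exact absurd ht (hno t ht.1 ht')
  head := by
    refine ⟨1, List.range' 2 (m - 1), ?_, ⟨⟨.inl rfl, fun _ => hd, fun h => absurd h (by lia)⟩, ?_⟩, ?_⟩
    · obtain ⟨k, rfl⟩ : ∃ k, m = k + 1 := ⟨m - 1, by lia⟩
      rw [List.range'_succ]; rfl
    · intro r hr hr'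
      exact absurd hr' (hno r hr'.1 hr)
    · rintro s ⟨⟨h | h | h, -⟩, -⟩
      · lia
      · lia
      · exact h.1.le
  last := by
    have hdir := same_direction hme le_rfl hno
    have hd' : d (m - 1) := (hdir (m - 1) (by lia) (by lia)).2 hd
    refine ⟨m, List.range' 1 (m - 1), ?_, ⟨⟨?_, ?_, fun _ => not_not.2 hd'⟩, ?_⟩, ?_⟩
    · obtain ⟨k, rfl⟩ : ∃ k, m = k + 1 := ⟨m - 1, by lia⟩
      rw [List.range'_concat]
      congr 2; lia
    · rw [turn_not]; exact .inr hmt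
    · intro hlt hdm
      rcases hmt with h | h
      · lia
      · exact h.2.2 ⟨fun _ => hdm, fun _ => hd'⟩
    · intro r hr hr'
      exact absurd hr' (hno r hr'.1 hr)
    · rintro s ⟨⟨h | h | h, h₁, -⟩, -⟩
      · subst h
        exact absurd hd (h₁ he)
      · lia
      · rw [turn_not] at h
        by_contra hcon
        exact hno s h.1 (by lia) h

end Straighten

end Biparabolic

namespace Biparabolic

/-! ### Extending the straightening past one turning point -/

section Straighten

variable {e : ℕ} {d neg : ℕ → Prop}

/-- The indices `m, m - 1, ..., t + 1`. -/
def descent (t m : ℕ) : List ℕ := (List.range' (t + 1) (m - t)).reverse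

lemma descent_eq_cons {t m : ℕ} (h : t < m) : ∃ l, descent t m = m :: l := by
  obtain ⟨k, rfl⟩ : ∃ k, m = t + 1 + k := ⟨m - (t + 1), by lia⟩
  refine ⟨(List.range' (t + 1) k).reverse, ?_⟩
  rw [descent, show t + 1 + k - t = k + 1 by lia, List.range'_concat, List.reverse_append, one_mul]
  rfl

lemma descent_eq_concat {t m : ℕ} (h : t < m) : ∃ l, descent t m = l ++ [t + 1] := by
  obtain ⟨k, rfl⟩ : ∃ k, m = t + 1 + k := ⟨m - (t + 1), by lia⟩
  refine ⟨(List.range' (t + 1 + 1) k).reverse, ?_⟩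
  rw [descent, show t + 1 + k - t = k + 1 by lia, List.range'_succ, List.reverse_cons]

lemma mem_listArcs_descent {t m x y : ℕ} (h : t < m) :
    (x, y) ∈ listArcs (descent t m) ↔ t + 1 ≤ y ∧ x = y + 1 ∧ y < m := by
  rw [descent, listArcs_reverse, Set.mem_preimage, Prod.swap_prod_mk, mem_listArcs_range']
  lia

lemma mem_descent {t m x : ℕ} : x ∈ descent t m ↔ t < x ∧ x ≤ m := by
  rw [descent, List.mem_reverse, List.mem_range'_1]
  lia

lemma nodup_descent (t m : ℕ) : (descent t m).Nodup :=
  List.nodup_reverse.2 List.nodup_range'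

lemma arcs_prepend_iff {A B C D : Prop} : (A ∨ B ∨ C ∨ D) ↔ (C ∨ A) ∨ D ∨ B := by tauto

lemma mem_insert_iff_or {A B C D F : Prop} : (A ∨ B ∨ D ∨ C ∨ F) ↔ (A ∨ B ∨ C ∨ F) ∨ D := by tauto

/-- Bookkeeping for inserting a block into a path: `p` is the broken arc, `a` and `b` lead into and
out of the block, `D` holds the arcs inside it, `L₁` and `L₂` the old arcs before and after; `X` and
`Y` are the old kept and external arcs. The side conditions say that the broken arc occurs once and
is not external. -/
lemma arcs_insert_iff {L₁ L₂ X Y D p a b : Prop} (h : (L₁ ∨ p ∨ L₂) ↔ (X ∨ Y)) (h₁ : p → ¬ L₁)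
    (h₂ : p → ¬ L₂) (h₃ : Y → ¬ p) :
    (L₁ ∨ a ∨ D ∨ b ∨ L₂) ↔ ((X ∧ ¬ p) ∨ b ∨ D) ∨ Y ∨ a := by
  by_cases hp : p
  · have := h₁ hp
    have := h₂ hp
    have : ¬ Y := fun hY => h₃ hY hp
    simp only [*, not_true_eq_false, and_false, false_or, or_false]
    tauto
  · simp only [hp, false_or, not_false_eq_true, and_true] at h ⊢
    clear h₁ h₂ h₃
    tauto

set_option maxHeartbeats 400000 in
/-- Extension of the straightening beyond a sink, up to the next turning index `m`. -/
lemma IsStraightening.exists_step {t m : ℕ} {l : List ℕ} (he : 1 < e)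
    (hcol : ∀ x, Turn e d x → Turn e d (x + 1) → neg x → neg (x + 1))
    (ht : Turn e d t) (hsnk : Snk e d t) (htm : t < m) (hme : m ≤ e) (hmt : m = e ∨ Turn e d m)
    (hno : ∀ x, t < x → x < m → ¬ Turn e d x) (hl : IsStraightening e d neg t l) :
    ∃ l', IsStraightening e d neg m l' := by
  have hnsrc : ¬ Src e d t := not_src_of_snk he hsnk
  have hdt : ¬ d t := hsnk.2.1 (by omega)
  have hdt' : d (t - 1) := not_not.1 (hsnk.2.2 ht.1)
  have ht1 := ht.1
  have hdir : ∀ i, t ≤ i → i < m → ¬ d i := fun i h₁ h₂ h =>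
    hdt ((same_direction hme ht.1.le hno i h₁ h₂).1 h)
  have hturn : ∀ x, Turn e d x → x < m → x < t ∨ x = t := by
    intro x hx hxm
    by_contra hcon
    exact hno x (by omega) hxm hx
  have hm1 : ¬ d (m - 1) := hdir _ (by omega) (by omega)
  have hsrcm : Src e d m := by
    refine ⟨.inr hmt, fun hlt => ?_, fun _ => hm1⟩
    rcases hmt with h | h
    · omega
    · by_contra hcon
      exact h.2.2 ⟨fun h => absurd h hm1, fun h => absurd h hcon⟩
  have hstops : ∀ s, Src e d s → t < s → m ≤ s := by
    intro s hs hts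
    by_contra hcon
    rcases hs.1 with h | h | h
    · omega
    · omega
    · exact hno s hts (by omega) h
  -- the candidates for the last entry do not change
  have hlastSet : headSet e d neg (Src e d) (Snk e d) m = headSet e d neg (Src e d) (Snk e d) t := by
    ext s
    refine and_congr_right fun _ => ⟨fun h r hr => h r (hr.trans htm), fun h r hr hr' hr'' => ?_⟩
    rcases hturn r hr' hr with h' | rfl
    · exact h r h' hr' hr''
    · exact absurd hr'' hnsrc
  have hext : ∀ q, (∃ t', Turn e d t' ∧ t' < m ∧ IsExternal e d neg t' q) ↔
      (∃ t', Turn e d t' ∧ t' < t ∧ IsExternal e d neg t' q) ∨ IsExternal e d neg t q := by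
    intro q
    constructor
    · rintro ⟨t', h₁, h₂, h₃⟩
      rcases hturn t' h₁ h₂ with h | rfl
      · exact .inl ⟨t', h₁, h, h₃⟩
      · exact .inr h₃
    · rintro (⟨t', h₁, h₂, h₃⟩ | h)
      · exact ⟨t', h₁, h₂.trans htm, h₃⟩
      · exact ⟨t, ht, htm, h⟩
  -- Negative signature: the arc `t + 1 → t` is deleted, and the external arc leads from `t + 1` to
  -- the current head, by the `head` invariant. So the descent `m, …, t + 1` is put in front.
  by_cases hneg : neg t
  · obtain ⟨h, l₀, rfl, hh⟩ := hl.head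
    obtain ⟨S₁, hS₁⟩ := descent_eq_cons htm
    obtain ⟨S₂, hS₂⟩ := descent_eq_concat htm
    refine ⟨descent t m ++ h :: l₀, ?_, ?_, ?_, ?_, ?_⟩
    · refine List.nodup_append.2 ⟨nodup_descent t m, hl.nodup, fun x hx y hy => ?_⟩
      rw [mem_descent] at hx
      rw [hl.mem] at hy
      omega
    · intro x
      rw [List.mem_append, mem_descent, hl.mem]
      omega
    · rintro ⟨x, y⟩
      have harcs : listArcs (descent t m ++ h :: l₀) =
          listArcs (descent t m) ∪ insert (t + 1, h) (listArcs (h :: l₀)) := by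
        rw [hS₂, List.append_assoc, List.singleton_append, listArcs_append]
      have hE : IsExternal e d neg t (x, y) ↔ (x, y) = (t + 1, h) := by
        constructor
        · rintro ⟨s, z, hz, ⟨h', -⟩ | ⟨-, h₁ | h₁, h₂⟩⟩
          · exact absurd h' hnsrc
          · exact absurd hneg h₁.1
          · rw [h₂, h₁.2.unique hh]
            rcases hz with hz | hz
            · exact absurd hneg hz.1
            · rw [hz.2]
        · intro h'
          exact ⟨h, t + 1, .inr ⟨hneg, rfl⟩, .inr ⟨hsnk, .inr ⟨hneg, hh⟩, h'⟩⟩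
      have hK : (x, y) ∈ keptArcs e d neg m ↔
          (x, y) ∈ keptArcs e d neg t ∨ (t + 1 ≤ y ∧ x = y + 1 ∧ y < m) := by
        constructor
        · rintro ⟨i, h₁, h₂, h₃, h₄⟩
          rcases lt_trichotomy i t with hit | rfl | hit
          · refine .inl ⟨i, h₁, hit, ?_, h₄⟩
            rintro ⟨t', h₅, h₆, h₇⟩
            exact h₃ ⟨t', h₅, h₆.trans htm, h₇⟩
          · exact absurd ⟨i, ht, htm, .inr ⟨hneg, rfl⟩⟩ h₃
          · rcases h₄ with h₄ | h₄
            · exact absurd h₄.1 (hdir i hit.le h₂)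
            · have := h₄.2
              rw [Prod.mk.injEq] at this
              exact .inr (by omega)
        · rintro (⟨i, h₁, h₂, h₃, h₄⟩ | ⟨h₁, rfl, h₃⟩)
          · refine ⟨i, h₁, h₂.trans htm, ?_, h₄⟩
            rintro ⟨t', h₅, h₆, h₇⟩
            rcases hturn t' h₅ h₆ with h | rfl
            · exact h₃ ⟨t', h₅, h, h₇⟩
            · rcases h₇ with h₇ | h₇
              · exact h₇.1 hneg
              · omega
          · refine ⟨y, by omega, h₃, ?_, .inr ⟨hdir y (by omega) h₃, rfl⟩⟩
            rintro ⟨t', h₅, h₆, h₇⟩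
            have := hturn t' h₅ h₆
            omega
      rw [harcs, Set.mem_union, Set.mem_insert_iff, mem_listArcs_descent htm, hl.arcs, hext, hE, hK]
      exact arcs_prepend_iff
    · refine ⟨m, S₁ ++ h :: l₀, by rw [hS₁]; rfl, ⟨hsrcm, ?_⟩, ?_⟩
      · exact fun r hr _ _ _ => hr
      -- The sink `t` is now itself a negative one before `m`, so candidates for the head lie beyond
      -- `t`.
      · rintro s ⟨hs, hs'⟩
        exact hstops s hs (hs' t htm ht hsnk hneg)
    · obtain ⟨k, l₁, h₁, h₂⟩ := hl.last
      exact ⟨k, descent t m ++ l₁, by rw [h₁, List.append_assoc], hlastSet ▸ h₂⟩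
  -- Positive signature: the arc `t - 1 → t` is replaced by an external arc `t - 1 → m`, so the
  -- descent goes between these two entries and both ends of the path stay. By `hcol` this arc was
  -- not already deleted on account of `t - 1`.
  · have hkept : (t - 1, t) ∈ keptArcs e d neg t := by
      refine ⟨t - 1, by omega, by omega, ?_, .inl ⟨hdt', by rw [Prod.mk.injEq]; lia⟩⟩
      rintro ⟨t', h₁, h₂, h₃ | h₃⟩
      · omega
      · have : t' + 1 = t := by omega
        exact hneg (this ▸ hcol t' h₁ (this.symm ▸ ht) h₃.1)
    obtain ⟨l₁, l₂, rfl⟩ := exists_split_of_mem_listArcs ((hl.arcs _).2 (.inl hkept))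
    simp only at hl
    obtain ⟨S₁, hS₁⟩ := descent_eq_cons htm
    obtain ⟨S₂, hS₂⟩ := descent_eq_concat htm
    refine ⟨l₁ ++ (t - 1) :: (descent t m ++ t :: l₂), ?_, ?_, ?_, ?_, ?_⟩
    · have hperm : (l₁ ++ (t - 1) :: (descent t m ++ t :: l₂)).Perm
          (descent t m ++ (l₁ ++ (t - 1) :: t :: l₂)) := by
        refine (List.Perm.append_left l₁ (List.perm_middle (a := t - 1)).symm).trans ?_
        rw [← List.append_assoc, ← List.append_assoc]
        exact List.Perm.append_right _ List.perm_append_comm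
      rw [hperm.nodup_iff]
      refine List.nodup_append.2 ⟨nodup_descent t m, hl.nodup, fun x hx y hy => ?_⟩
      rw [mem_descent] at hx
      rw [hl.mem] at hy
      omega
    · intro x
      have h₁ := hl.mem x
      have h₂ := mem_descent (t := t) (m := m) (x := x)
      simp only [List.mem_append, List.mem_cons] at h₁ ⊢
      rw [h₂, mem_insert_iff_or, h₁]
      omega
    · rintro ⟨x, y⟩
      have harcs : listArcs (l₁ ++ (t - 1) :: (descent t m ++ t :: l₂)) =
          listArcs (l₁ ++ [t - 1]) ∪ insert (t - 1, m)
            (listArcs (descent t m) ∪ insert (t + 1, t) (listArcs (t :: l₂))) := by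
        have h₁ : listArcs (descent t m ++ t :: l₂) =
            listArcs (descent t m) ∪ insert (t + 1, t) (listArcs (t :: l₂)) := by
          rw [hS₂, List.append_assoc, List.singleton_append, listArcs_append]
        rw [← h₁, hS₁, List.cons_append, listArcs_append]
      have hold := hl.arcs (x, y)
      rw [listArcs_append, Set.mem_union, Set.mem_insert_iff] at hold
      have hsplit := List.nodup_append.1 hl.nodup
      have hA₁ : (x, y) = (t - 1, t) → (x, y) ∉ listArcs (l₁ ++ [t - 1]) := by
        rintro h hmem
        rw [Prod.mk.injEq] at h
        have := (mem_of_mem_listArcs hmem).2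
        rw [List.mem_append, List.mem_singleton] at this
        rcases this with h' | h'
        · exact hsplit.2.2 y h' y (by simp [h.2]) rfl
        · simp only at h'
          omega
      have hA₂ : (x, y) = (t - 1, t) → (x, y) ∉ listArcs (t :: l₂) := by
        rintro h hmem
        rw [Prod.mk.injEq] at h
        have := (mem_of_mem_listArcs hmem).1
        rw [h.1] at this
        exact (List.nodup_cons.1 hsplit.2.1).1 this
      have hE : IsExternal e d neg t (x, y) ↔ (x, y) = (t - 1, m) := by
        have hleast : IsLeast {s | Src e d s ∧ t < s} m := ⟨⟨hsrcm, htm⟩, fun s hs => hstops s hs.1 hs.2⟩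
        constructor
        · rintro ⟨s, z, hz, ⟨h', -⟩ | ⟨-, h₁ | h₁, h₂⟩⟩
          · exact absurd h' hnsrc
          · rw [h₂, h₁.2.unique hleast]
            rcases hz with hz | hz
            · rw [Prod.mk.injEq]
              omega
            · exact absurd hz.1 hneg
          · exact absurd h₁.1 hneg
        · intro h'
          exact ⟨m, t - 1, .inl ⟨hneg, by omega⟩, .inr ⟨hsnk, .inl ⟨hneg, hleast⟩, h'⟩⟩
      -- For an earlier source, the arc `(t - 1, t)` would start at that source, although the
      -- crossed index is a sink. For an earlier sink, it would end at the sink `t`, although the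
      -- crossed index is a source.
      have hEold : ∀ t', Turn e d t' → t' < t → IsExternal e d neg t' (x, y) → (x, y) ≠ (t - 1, t) := by
        rintro t' h₁ h₂ ⟨s, z, hz, ⟨h₃, h₄, h₅⟩ | ⟨h₃, h₄, h₅⟩⟩ h₆
        · rw [h₆, Prod.mk.injEq] at h₅
          have hst : s = t' := by omega
          have hs : Snk e d s := by
            rcases h₄ with h₄ | h₄
            · exact h₄.2.1.1
            · exact h₄.2.1.1
          exact not_src_of_snk he hs (hst ▸ h₃)
        · rw [h₆, Prod.mk.injEq] at h₅
          have hs : Src e d s := by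
            rcases h₄ with h₄ | h₄
            · exact h₄.2.1.1
            · exact h₄.2.1.1
          exact hnsrc (h₅.2 ▸ hs)
      have hK : (x, y) ∈ keptArcs e d neg m ↔
          ((x, y) ∈ keptArcs e d neg t ∧ (x, y) ≠ (t - 1, t)) ∨ (x, y) = (t + 1, t) ∨
            (t + 1 ≤ y ∧ x = y + 1 ∧ y < m) := by
        constructor
        · rintro ⟨i, h₁, h₂, h₃, h₄⟩
          rcases lt_or_ge i t with hit | hit
          · refine .inl ⟨⟨i, h₁, hit, ?_, h₄⟩, ?_⟩
            · rintro ⟨t', h₅, h₆, h₇⟩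
              exact h₃ ⟨t', h₅, h₆.trans htm, h₇⟩
            · intro hxy
              refine h₃ ⟨t, ht, htm, .inl ⟨hneg, ?_⟩⟩
              rcases h₄ with h₄ | h₄
              · have := h₄.2
                rw [hxy, Prod.mk.injEq] at this
                omega
              · have := h₄.2
                rw [hxy, Prod.mk.injEq] at this
                omega
          · rcases h₄ with h₄ | h₄
            · exact absurd h₄.1 (hdir i hit h₂)
            · have := h₄.2
              rw [Prod.mk.injEq] at this
              rw [Prod.mk.injEq]
              exact .inr (by omega)
        · have hback : ∀ y, t ≤ y → y < m → (y + 1, y) ∈ keptArcs e d neg m := by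
            intro y h₁ h₃
            refine ⟨y, by omega, h₃, ?_, .inr ⟨hdir y (by omega) h₃, rfl⟩⟩
            rintro ⟨t', h₅, h₆, h₇⟩
            have := hturn t' h₅ h₆
            rcases h₇ with h₇ | h₇
            · omega
            · have : t' = t := by omega
              exact hneg (this ▸ h₇.1)
          rintro (⟨⟨i, h₁, h₂, h₃, h₄⟩, h₅⟩ | h | ⟨h₁, rfl, h₃⟩)
          · refine ⟨i, h₁, h₂.trans htm, ?_, h₄⟩
            rintro ⟨t', h₆, h₇, h₈⟩
            rcases hturn t' h₆ h₇ with h | rfl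
            · exact h₃ ⟨t', h₆, h, h₈⟩
            · rcases h₈ with h₈ | h₈
              · rcases h₄ with h₄ | h₄
                · refine h₅ (h₄.2.trans ?_)
                  rw [Prod.mk.injEq]
                  omega
                · exact h₄.1 (by rwa [show i = t' - 1 by omega])
              · exact hneg h₈.1
          · rw [h]
            exact hback t le_rfl htm
          · exact hback y (by omega) h₃
      have hEold' : (∃ t', Turn e d t' ∧ t' < t ∧ IsExternal e d neg t' (x, y)) → (x, y) ≠ (t - 1, t) :=
        fun ⟨t', h₁, h₂, h₃⟩ => hEold t' h₁ h₂ h₃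
      rw [harcs, Set.mem_union, Set.mem_insert_iff, Set.mem_union, Set.mem_insert_iff,
        mem_listArcs_descent htm, hext, hE, hK]
      exact arcs_insert_iff hold hA₁ hA₂ hEold'
    · obtain ⟨h, l', h₁, h₂⟩ := hl.head
      have hset : headSet e d neg (Snk e d) (Src e d) m = headSet e d neg (Snk e d) (Src e d) t := by
        ext s
        refine and_congr_right fun _ => ⟨fun h r hr => h r (hr.trans htm), fun h r hr hr' _ hr'' => ?_⟩
        rcases hturn r hr' hr with h' | rfl
        · exact h r h' hr' ‹_› hr''
        · exact absurd hr'' hneg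
      rw [hset]
      cases l₁ with
      | nil =>
        rw [List.nil_append, List.cons.injEq] at h₁
        exact ⟨h, _, by rw [← h₁.1]; rfl, h₂⟩
      | cons a l₁ =>
        rw [List.cons_append, List.cons.injEq] at h₁
        exact ⟨h, _, by rw [← h₁.1]; rfl, h₂⟩
    · obtain ⟨k, l', h₁, h₂⟩ := hl.last
      rw [hlastSet]
      have : ∃ l₃, t :: l₂ = l₃ ++ [k] := by
        rcases List.eq_nil_or_concat' (t :: l₂) with h | ⟨l₃, b, h⟩
        · simp at h
        · refine ⟨l₃, ?_⟩
          rw [h, ← List.cons_append, ← List.append_assoc] at h₁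
          rw [h, ((List.append_inj' h₁ rfl).2)]
      obtain ⟨l₃, h₃⟩ := this
      exact ⟨k, l₁ ++ (t - 1) :: (descent t m ++ l₃), by rw [h₃]; simp, h₂⟩

/-- Strong induction through the last turning index before `m`; if it is a source, the step is
applied with all directions reversed. -/
lemma exists_isStraightening (he : 1 < e)
    (hcol : ∀ x, Turn e d x → Turn e d (x + 1) → neg x → neg (x + 1)) (m : ℕ) (hm : 1 < m)
    (hme : m ≤ e) (hmt : m = e ∨ Turn e d m) : ∃ l, IsStraightening e d neg m l := by
  induction m using Nat.strong_induction_on with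
  | _ m ih =>
    have notnot : (fun i => ¬ ¬ d i) = d := funext fun i => propext not_not
    by_cases hex : ∃ t, Turn e d t ∧ t < m
    · classical
      obtain ⟨t, ⟨ht, htm⟩, hmax⟩ : ∃ t, (Turn e d t ∧ t < m) ∧ ∀ x, Turn e d x ∧ x < m → x ≤ t := by
        obtain ⟨t₀, h₀⟩ := hex
        have hs := Nat.findGreatest_spec (P := fun t => Turn e d t ∧ t < m) (n := m) h₀.2.le h₀
        exact ⟨_, hs, fun x hx => Nat.le_findGreatest hx.2.le hx⟩
      have hno : ∀ x, t < x → x < m → ¬ Turn e d x := fun x h₁ h₂ h => by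
        have := hmax x ⟨h, h₂⟩
        omega
      obtain ⟨l, hl⟩ := ih t htm ht.1 ht.2.1.le (.inr ht)
      by_cases hd : d t
      · have hd' : ¬ d (t - 1) := fun h => ht.2.2 ⟨fun _ => hd, fun _ => h⟩
        have hsnk : Snk e (fun i => ¬ d i) t := by
          rw [snk_not]
          exact ⟨.inr (.inr ht), fun _ => hd, fun _ => hd'⟩
        obtain ⟨l', hl'⟩ := hl.reverse.exists_step he (by simpa only [turn_not] using hcol)
          ((turn_not t).2 ht) hsnk htm hme (by simpa only [turn_not] using hmt)
          (by simpa only [turn_not] using hno)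
        have := hl'.reverse
        rw [notnot] at this
        exact ⟨_, this⟩
      · have hd' : d (t - 1) := by
          by_contra h
          exact ht.2.2 ⟨fun h' => absurd h' h, fun h' => absurd h' hd⟩
        exact hl.exists_step he hcol ht
          ⟨by rw [turn_not]; exact .inr (.inr ht), fun _ => hd, fun _ => not_not.2 hd'⟩ htm hme hmt hno
    · push Not at hex
      have hno : ∀ x, 1 < x → x < m → ¬ Turn e d x := fun x _ h₂ h => by
        have := hex x h
        omega
      by_cases hd : d 1
      · exact ⟨_, isStraightening_base he hm hme hmt hno hd⟩
      · have := (isStraightening_base (neg := neg) (d := fun i => ¬ d i) he hm hme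
          (by simpa only [turn_not] using hmt) (by simpa only [turn_not] using hno) hd).reverse
        rw [notnot] at this
        exact ⟨_, this⟩

end Straighten

end Biparabolic

namespace Biparabolic

/-! ### The enumeration of an edge -/

/-- `x` lies before `y` for the direction of the arcs on the side `s`. -/
def Before : Side → ℤ → ℤ → Prop
  | .above, x, y => x < y
  | .below, x, y => y < x

lemma mem_S_iff {σ : Side → Equiv.Perm ℤ} {x y : ℤ} :
    (x, y) ∈ S σ ↔ ∃ s, σ s x = y ∧ Before s x y := by
  constructor
  · rintro (⟨h, h'⟩ | ⟨h, h'⟩)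
    exacts [⟨.above, h', h⟩, ⟨.below, h', h⟩]
  · rintro ⟨_ | _, h', h⟩
    exacts [.inl ⟨h, h'⟩, .inr ⟨h, h'⟩]

lemma Before.ne {s : Side} {x y : ℤ} (h : Before s x y) : x ≠ y := by
  cases s
  exacts [LT.lt.ne h, LT.lt.ne' h]

lemma before_comm {s : Side} {x y : ℤ} (h : x ≠ y) : Before s y x ↔ ¬ Before s x y := by
  cases s <;> simp only [Before] <;> lia

lemma Side.flip_ne (s : Side) : s.flip ≠ s := by cases s <;> simp [Side.flip]

lemma Side.eq_or_eq_flip (s t : Side) : s = t ∨ s = t.flip := by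
  cases s <;> cases t <;> simp [Side.flip]

lemma Side.flip_flip (s : Side) : s.flip.flip = s := by cases s <;> rfl

/-- `φ` enumerates the `e` points of the edge `E` starting from an end-point. -/
structure IsEnumeration (σ : Side → Equiv.Perm ℤ) (E : Set ℤ) (a : ℤ) (e : ℕ) : Prop where
  involutive : ∀ s, Function.Involutive (σ s)
  one_lt : 1 < e
  injOn : Set.InjOn (phi σ a) (Set.Icc 1 e)
  image : phi σ a '' Set.Icc 1 e = E
  last : phi σ a (e + 1) = phi σ a e
  first : σ (arcSide σ a 0) a = a

lemma phi_succ {σ : Side → Equiv.Perm ℤ} {a : ℤ} (h : σ (arcSide σ a 0) a = a) (t : ℕ) :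
    phi σ a (t + 1) = σ (arcSide σ a t) (phi σ a t) := by
  cases t with
  | zero => exact h.symm
  | succ t => rfl

lemma arcSide_double (σ : Side → Equiv.Perm ℤ) (a : ℤ) (k : ℕ) :
    arcSide σ a (2 * k) = arcSide σ a 0 := by
  induction k with
  | zero => rfl
  | succ k ih =>
    have : arcSide σ a (2 * k + 1 + 1) = (arcSide σ a (2 * k)).flip.flip := rfl
    rw [show 2 * (k + 1) = 2 * k + 1 + 1 by ring, this, Side.flip_flip, ih]

section Enumeration

variable {σ : Side → Equiv.Perm ℤ} {E : Set ℤ} {a : ℤ}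

/-- The involutions alternate and each inverts their product, so the indices `1, 2, 3, 4, 5, …`
correspond to the exponents `0, 1, -1, 2, -2, …`. -/
lemma phi_eq_zpow (hinv : ∀ s, Function.Involutive (σ s)) (h : σ (arcSide σ a 0) a = a) (k : ℕ) :
    phi σ a (2 * k) = ((σ (arcSide σ a 1) * σ (arcSide σ a 0)) ^ (k : ℤ)) a ∧
      phi σ a (2 * k + 1) = ((σ (arcSide σ a 1) * σ (arcSide σ a 0)) ^ (-k : ℤ)) a := by
  have hodd : ∀ k, phi σ a (2 * k) = ((σ (arcSide σ a 1) * σ (arcSide σ a 0)) ^ (k : ℤ)) a →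
      phi σ a (2 * k + 1) = ((σ (arcSide σ a 1) * σ (arcSide σ a 0)) ^ (-k : ℤ)) a := by
    intro k hk
    rw [phi_succ h, arcSide_double, hk, (apply_zpow (hinv _) (hinv _) _ _).2, h]
  induction k with
  | zero => exact ⟨rfl, hodd 0 rfl⟩
  | succ k ih =>
    have key : phi σ a (2 * (k + 1)) =
        ((σ (arcSide σ a 1) * σ (arcSide σ a 0)) ^ ((k + 1 : ℕ) : ℤ)) a := by
      rw [show 2 * (k + 1) = 2 * k + 1 + 1 by ring, phi_succ h, ih.2,
        show arcSide σ a (2 * k + 1) = arcSide σ a 1 from congrArg Side.flip (arcSide_double σ a k),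
        (apply_zpow (hinv _) (hinv _) _ _).1, neg_neg]
      have : σ (arcSide σ a 1) a = (σ (arcSide σ a 1) * σ (arcSide σ a 0)) a := by
        rw [Equiv.Perm.mul_apply, h]
      rw [this, ← Equiv.Perm.mul_apply, ← zpow_add_one]
      push_cast
      rfl
    exact ⟨key, hodd _ key⟩

lemma closure_pair_eq (f g : Equiv.Perm ℤ) : Subgroup.closure {f, g} = Subgroup.closure {g, f} := by
  rw [Set.pair_comm]

/-- The rotation `ρ` is a cycle of length `e` on `E`. The exponents of the first `e` indices are
distinct modulo `e`, while those of `e` and `e + 1` are congruent, so the walk stops at a fixed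
point. -/
lemma isEnumeration (hinv : ∀ s, Function.Involutive (σ s)) (hfin : E.Finite)
    (hE : IsEdge (σ .above) (σ .below) E) (hnt : E.Nontrivial) (ha : IsEdgeEnd σ E a) :
    IsEnumeration σ E a E.ncard := by
  have hone : 1 < E.ncard := by
    have : Finite E := hfin
    exact Set.one_lt_ncard_iff_nontrivial.2 hnt
  have hfirst : σ (arcSide σ a 0) a = a := by
    rw [arcSide]
    split_ifs with h
    · exact h
    · obtain ⟨-, s, hs⟩ := ha
      cases s
      exacts [absurd hs h, hs]
  set ρ := σ (arcSide σ a 1) * σ (arcSide σ a 0) with hρ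
  have hEρ : E = MulAction.orbit (Subgroup.zpowers ρ) a := by
    obtain ⟨x, hx, -⟩ := hE
    rw [hρ, ← orbit_eq_of_fixed (hinv _) (hinv _) (.inr hfirst), hx]
    have hax : a ∈ MulAction.orbit (Subgroup.closure {σ .above, σ .below}) x := hx ▸ ha.1
    rw [← MulAction.orbit_eq_iff.2 hax]
    have : arcSide σ a 1 = (arcSide σ a 0).flip := rfl
    rw [this]
    cases arcSide σ a 0
    · rw [Side.flip, closure_pair_eq]
    · rfl
  have hper : Function.minimalPeriod (ρ • ·) a = E.ncard := by
    have hfin' : Finite (MulAction.orbit (Subgroup.zpowers ρ) a) := by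
      rw [← hEρ]; exact hfin
    have := Fintype.ofFinite (MulAction.orbit (Subgroup.zpowers ρ) a)
    rw [MulAction.minimalPeriod_eq_card, hEρ, Set.ncard_eq_toFinset_card', Set.toFinset_card]
  have hdvd : ∀ i j : ℤ, (ρ ^ i) a = (ρ ^ j) a ↔ (E.ncard : ℤ) ∣ i - j := by
    intro i j
    rw [← hper, ← MulAction.zpow_smul_eq_iff_minimalPeriod_dvd, zpow_sub, Equiv.Perm.smul_def,
      Equiv.Perm.mul_apply]
    have hc : (ρ ^ i) ((ρ ^ j)⁻¹ a) = (ρ ^ j)⁻¹ ((ρ ^ i) a) := by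
      rw [← Equiv.Perm.mul_apply, ← Equiv.Perm.mul_apply, ← zpow_neg, ← zpow_add, ← zpow_add,
        add_comm]
    rw [hc, Equiv.Perm.inv_eq_iff_eq]
  have hphi := phi_eq_zpow hinv hfirst
  rw [← hρ] at hphi
  have hinj : Set.InjOn (phi σ a) (Set.Icc 1 E.ncard) := by
    have small : ∀ z : ℤ, (E.ncard : ℤ) ∣ z → |z| < E.ncard → z = 0 := fun z h h' =>
      Int.eq_zero_of_abs_lt_dvd h h'
    intro i hi j hj hij
    rw [Set.mem_Icc] at hi hj
    obtain ⟨k, rfl | rfl⟩ := Nat.even_or_odd' i <;> obtain ⟨m, rfl | rfl⟩ := Nat.even_or_odd' j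
    · rw [(hphi k).1, (hphi m).1, hdvd] at hij
      have := small _ hij (by rw [abs_lt]; constructor <;> lia)
      lia
    · rw [(hphi k).1, (hphi m).2, hdvd] at hij
      have := small _ hij (by rw [abs_lt]; constructor <;> lia)
      lia
    · rw [(hphi k).2, (hphi m).1, hdvd] at hij
      have := small _ hij (by rw [abs_lt]; constructor <;> lia)
      lia
    · rw [(hphi k).2, (hphi m).2, hdvd] at hij
      have := small _ hij (by rw [abs_lt]; constructor <;> lia)
      lia
  refine ⟨hinv, hone, hinj, ?_, ?_, hfirst⟩
  · refine Set.eq_of_subset_of_ncard_le ?_ ?_ hfin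
    · rintro _ ⟨i, -, rfl⟩
      rw [hEρ, hρ, mem_orbit_zpowers, ← hρ]
      obtain ⟨k, rfl | rfl⟩ := Nat.even_or_odd' i
      exacts [⟨_, (hphi k).1.symm⟩, ⟨_, (hphi k).2.symm⟩]
    · rw [hinj.ncard_image, Set.ncard_eq_toFinset_card' (Set.Icc 1 E.ncard), Set.toFinset_Icc,
        Nat.card_Icc, Nat.add_sub_cancel]
  · obtain ⟨k, hk | hk⟩ := Nat.even_or_odd' E.ncard
    · rw [hk, (hphi k).1, (hphi k).2, hdvd]
      exact ⟨-1, by lia⟩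
    · rw [hk, show 2 * k + 1 + 1 = 2 * (k + 1) by ring, (hphi k).2, (hphi (k + 1)).1, hdvd]
      exact ⟨1, by lia⟩

namespace IsEnumeration

variable {e : ℕ} (N : IsEnumeration σ E a e)

include N

lemma phi_succ (t : ℕ) : phi σ a (t + 1) = σ (arcSide σ a t) (phi σ a t) :=
  Biparabolic.phi_succ N.first t

lemma apply_phi_succ (t : ℕ) : σ (arcSide σ a t) (phi σ a (t + 1)) = phi σ a t := by
  rw [N.phi_succ, N.involutive]

/-- At `t = 1` the second alternative relies on the default value `φ(0) = a = φ(1)`: the side of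
index 0 fixes `a`. -/
lemma apply_phi (s : Side) (t : ℕ) (ht : 1 ≤ t) :
    (s = arcSide σ a t ∧ σ s (phi σ a t) = phi σ a (t + 1)) ∨
      (s = arcSide σ a (t - 1) ∧ σ s (phi σ a t) = phi σ a (t - 1)) := by
  obtain ⟨k, rfl⟩ : ∃ k, t = k + 1 := ⟨t - 1, by lia⟩
  rcases Side.eq_or_eq_flip s (arcSide σ a (k + 1)) with rfl | rfl
  · exact .inl ⟨rfl, (N.phi_succ _).symm⟩
  · rw [arcSide, Side.flip_flip]
    exact .inr ⟨rfl, N.apply_phi_succ k⟩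

lemma phi_inj {i j : ℕ} (hi : 1 ≤ i) (hi' : i ≤ e) (hj : 1 ≤ j) (hj' : j ≤ e) :
    phi σ a i = phi σ a j ↔ i = j :=
  ⟨fun h => N.injOn ⟨hi, hi'⟩ ⟨hj, hj'⟩ h, fun h => h ▸ rfl⟩

lemma phi_mem {i : ℕ} (hi : 1 ≤ i) (hi' : i ≤ e) : phi σ a i ∈ E := N.image ▸ ⟨i, ⟨hi, hi'⟩, rfl⟩

lemma exists_index {x : ℤ} (hx : x ∈ E) : ∃ i, 1 ≤ i ∧ i ≤ e ∧ phi σ a i = x := by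
  rw [← N.image] at hx
  obtain ⟨i, hi, rfl⟩ := hx
  exact ⟨i, hi.1, hi.2, rfl⟩

lemma phi_ne_succ {i : ℕ} (hi : 1 ≤ i) (hi' : i < e) : phi σ a i ≠ phi σ a (i + 1) := fun h => by
  have := (N.phi_inj hi hi'.le (by lia) (by lia)).1 h
  lia

lemma apply_mem (s : Side) {x : ℤ} (hx : x ∈ E) : σ s x ∈ E := by
  obtain ⟨i, hi, hi', rfl⟩ := N.exists_index hx
  rcases N.apply_phi s i hi with ⟨-, h⟩ | ⟨-, h⟩ <;> rw [h]
  · rcases eq_or_lt_of_le hi' with rfl | h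
    · rw [N.last]
      exact N.phi_mem hi le_rfl
    · exact N.phi_mem (by lia) h
  · rcases eq_or_lt_of_le hi with rfl | h
    · exact N.phi_mem (i := 1) le_rfl hi'
    · exact N.phi_mem (by lia) (by lia)

lemma fixed_iff {s : Side} {t : ℕ} (ht : 1 ≤ t) (ht' : t ≤ e) :
    σ s (phi σ a t) = phi σ a t ↔ (t = 1 ∧ s = arcSide σ a 0) ∨ (t = e ∧ s = arcSide σ a e) := by
  have h1 := N.one_lt
  have hflip : ∀ k, arcSide σ a (k + 1) ≠ arcSide σ a k := fun k => Side.flip_ne _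
  obtain ⟨k, rfl⟩ : ∃ k, t = k + 1 := ⟨t - 1, by lia⟩
  rcases N.apply_phi s (k + 1) ht with ⟨rfl, h⟩ | ⟨rfl, h⟩ <;> rw [h]
  · constructor
    · intro h'
      rcases eq_or_lt_of_le ht' with rfl | hlt
      · exact .inr ⟨rfl, rfl⟩
      · exact absurd h'.symm (N.phi_ne_succ ht hlt)
    · rintro (⟨h', h''⟩ | ⟨rfl, -⟩)
      · obtain rfl : k = 0 := by lia
        exact absurd h'' (hflip 0)
      · exact N.last
  · rw [Nat.add_sub_cancel]
    constructor
    · intro h'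
      rcases Nat.eq_zero_or_pos k with rfl | hk
      · exact .inl ⟨rfl, rfl⟩
      · exact absurd h' (N.phi_ne_succ hk ht')
    · rintro (⟨h', -⟩ | ⟨rfl, h''⟩)
      · obtain rfl : k = 0 := by lia
        rfl
      · exact absurd h''.symm (hflip k)

end IsEnumeration

/-- The arc joining `φ(t)` and `φ(t+1)` points to `φ(t+1)`. -/
def Forward (σ : Side → Equiv.Perm ℤ) (a : ℤ) (t : ℕ) : Prop :=
  Before (arcSide σ a t) (phi σ a t) (phi σ a (t + 1))

/-! ### Arcs of `S`, turning points, sources and sinks in terms of indices -/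

namespace IsEnumeration

variable {e : ℕ} (N : IsEnumeration σ E a e)

include N

lemma mem_S {i : ℕ} {y : ℤ} (hi : 1 ≤ i) (hi' : i ≤ e) : (phi σ a i, y) ∈ S σ ↔
    (i < e ∧ Forward σ a i ∧ y = phi σ a (i + 1)) ∨
      (1 < i ∧ ¬ Forward σ a (i - 1) ∧ y = phi σ a (i - 1)) := by
  rw [mem_S_iff]
  obtain ⟨k, rfl⟩ : ∃ k, i = k + 1 := ⟨i - 1, by lia⟩
  constructor
  · rintro ⟨s, rfl, hB⟩
    rcases N.apply_phi s (k + 1) hi with ⟨rfl, h⟩ | ⟨rfl, h⟩ <;> rw [h] at hB ⊢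
    · rcases eq_or_lt_of_le hi' with rfl | hlt
      · exact absurd N.last.symm hB.ne
      · exact .inl ⟨hlt, hB, rfl⟩
    · rcases Nat.eq_zero_or_pos k with rfl | hk
      · exact absurd rfl hB.ne
      · rw [Nat.add_sub_cancel] at *
        exact .inr ⟨by lia, (before_comm (N.phi_ne_succ hk hi')).1 hB, rfl⟩
  · rintro (⟨h₁, h₂, rfl⟩ | ⟨h₁, h₂, rfl⟩)
    · exact ⟨_, (N.phi_succ _).symm, h₂⟩
    · rw [Nat.add_sub_cancel] at *
      exact ⟨_, N.apply_phi_succ k, (before_comm (N.phi_ne_succ (by lia) hi')).2 h₂⟩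

lemma mem_S' {i : ℕ} {y : ℤ} (hi : 1 ≤ i) (hi' : i ≤ e) : (y, phi σ a i) ∈ S σ ↔
    (i < e ∧ ¬ Forward σ a i ∧ y = phi σ a (i + 1)) ∨
      (1 < i ∧ Forward σ a (i - 1) ∧ y = phi σ a (i - 1)) := by
  constructor
  · intro h
    have hy : y ∈ E := by
      obtain ⟨s, hs, -⟩ := mem_S_iff.1 h
      have := N.apply_mem s (N.phi_mem hi hi')
      rwa [← hs, N.involutive] at this
    obtain ⟨j, hj, hj', rfl⟩ := N.exists_index hy
    rcases (N.mem_S hj hj').1 h with ⟨h₁, h₂, h₃⟩ | ⟨h₁, h₂, h₃⟩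
    · rw [N.phi_inj hi hi' (by lia) (by lia)] at h₃
      subst h₃
      exact .inr ⟨by lia, h₂, rfl⟩
    · rw [N.phi_inj hi hi' (by lia) (by lia)] at h₃
      subst h₃
      exact .inl ⟨by lia, h₂, by congr 1; lia⟩
  · rintro (⟨h₁, h₂, rfl⟩ | ⟨h₁, h₂, rfl⟩)
    · exact (N.mem_S (by lia) (by lia)).2 (.inr ⟨by lia, h₂, rfl⟩)
    · exact (N.mem_S (by lia) (by lia)).2 (.inl ⟨by lia, h₂, by congr 1; lia⟩)

/-- Sides alternate, and so do their orientations. Hence the arrows clash at `φ(t)` exactly when the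
positions keep increasing or keep decreasing there. -/
lemma isInternalTurning_iff (t : ℕ) : IsInternalTurning σ a e t ↔ Turn e (Forward σ a) t := by
  refine and_congr_right fun h₁ => and_congr_right fun h₂ => ?_
  obtain ⟨k, rfl⟩ : ∃ k, t = k + 1 := ⟨t - 1, by lia⟩
  rw [Nat.add_sub_cancel]
  have hne := N.phi_ne_succ (i := k) (by lia) (by lia)
  have hne' := N.phi_ne_succ (i := k + 1) (by lia) h₂
  rw [Forward, Forward, show arcSide σ a (k + 1) = (arcSide σ a k).flip from rfl, mul_neg_iff]
  cases arcSide σ a k <;> simp only [Side.flip, Before] <;> lia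

lemma isTurning_iff (t : ℕ) :
    IsTurning σ a e t ↔ t = 1 ∨ t = e ∨ Turn e (Forward σ a) t := by
  rw [IsTurning, N.isInternalTurning_iff]

lemma isSource_iff (t : ℕ) : IsSource σ a e t ↔ Src e (Forward σ a) t := by
  rw [IsSource, Src, N.isTurning_iff]
  refine and_congr_right fun h => ?_
  have he := N.one_lt
  have hb : 1 ≤ t ∧ t ≤ e := by
    rcases h with h | h | h
    · lia
    · lia
    · exact ⟨h.1.le, h.2.1.le⟩
  constructor
  · intro h'
    refine ⟨fun hlt => ?_, fun hlt hf => ?_⟩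
    · by_contra hf
      exact h' _ ((N.mem_S' hb.1 hb.2).2 (.inl ⟨hlt, hf, rfl⟩))
    · exact h' _ ((N.mem_S' hb.1 hb.2).2 (.inr ⟨hlt, hf, rfl⟩))
  · rintro ⟨h₁, h₂⟩ y hy
    rcases (N.mem_S' hb.1 hb.2).1 hy with ⟨h₃, h₄, -⟩ | ⟨h₃, h₄, -⟩
    exacts [h₄ (h₁ h₃), h₂ h₃ h₄]

lemma isSink_iff (t : ℕ) : IsSink σ a e t ↔ Snk e (Forward σ a) t := by
  rw [IsSink, Snk, Src, N.isTurning_iff, turn_not]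
  refine and_congr_right fun h => ?_
  have he := N.one_lt
  have hb : 1 ≤ t ∧ t ≤ e := by
    rcases h with h | h | h
    · lia
    · lia
    · exact ⟨h.1.le, h.2.1.le⟩
  constructor
  · intro h'
    refine ⟨fun hlt hf => ?_, fun hlt hf => ?_⟩
    · exact h' _ ((N.mem_S hb.1 hb.2).2 (.inl ⟨hlt, hf, rfl⟩))
    · exact h' _ ((N.mem_S hb.1 hb.2).2 (.inr ⟨hlt, hf, rfl⟩))
  · rintro ⟨h₁, h₂⟩ y hy
    rcases (N.mem_S hb.1 hb.2).1 hy with ⟨h₃, h₄, -⟩ | ⟨h₃, h₄, -⟩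
    exacts [h₁ h₃ h₄, h₂ h₃ h₄]

end IsEnumeration

end Enumeration

end Biparabolic

namespace Biparabolic

/-! ### Aligned edges -/

/-- The start is the only point of `V` at which no arc arrives, the finish the only one from which
none departs. -/
lemma IsAlignedEdge.unique {A : Set (ℤ × ℤ)} {V : Set ℤ} {x y x' y' : ℤ}
    (h : IsAlignedEdge A V x y) (h' : IsAlignedEdge A V x' y') : x = x' ∧ y = y' := by
  obtain ⟨p, ψ, hp, hinj, himg, hA, rfl, rfl⟩ := h
  obtain ⟨p', ψ', hp', hinj', himg', hA', rfl, rfl⟩ := h'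
  constructor
  · have hx : ψ 1 ∈ V := himg ▸ ⟨1, ⟨le_rfl, by lia⟩, rfl⟩
    rw [← himg'] at hx
    obtain ⟨j, ⟨hj, hj'⟩, hjx⟩ := hx
    rcases eq_or_lt_of_le hj with rfl | hlt
    · exact hjx.symm
    · have : (ψ' (j - 1), ψ 1) ∈ A := by
        rw [hA']
        exact ⟨j - 1, by lia, by lia, by rw [Nat.sub_add_cancel hj, hjx]⟩
      rw [hA] at this
      obtain ⟨i, hi, hi', h⟩ := this
      have := hinj ⟨le_rfl, by lia⟩ ⟨by lia, by lia⟩ (Prod.mk.inj h).2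
      lia
  · have hx : ψ p ∈ V := himg ▸ ⟨p, ⟨by lia, le_rfl⟩, rfl⟩
    rw [← himg'] at hx
    obtain ⟨j, ⟨hj, hj'⟩, hjx⟩ := hx
    rcases eq_or_lt_of_le hj' with rfl | hlt
    · exact hjx.symm
    · have : (ψ p, ψ' (j + 1)) ∈ A := by
        rw [hA']
        exact ⟨j, hj, hlt, by rw [hjx]⟩
      rw [hA] at this
      obtain ⟨i, hi, hi', h⟩ := this
      have := hinj ⟨by lia, le_rfl⟩ ⟨by lia, by lia⟩ (Prod.mk.inj h).1
      lia

lemma IsAlignedEdge.ne {A : Set (ℤ × ℤ)} {V : Set ℤ} {x y : ℤ} (h : IsAlignedEdge A V x y) :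
    x ≠ y ∧ x ∈ V ∧ y ∈ V := by
  obtain ⟨p, ψ, hp, hinj, rfl, -, rfl, rfl⟩ := h
  refine ⟨fun h => ?_, ⟨1, ⟨le_rfl, by lia⟩, rfl⟩, ⟨p, ⟨by lia, le_rfl⟩, rfl⟩⟩
  have := hinj ⟨le_rfl, by lia⟩ ⟨by lia, le_rfl⟩ h
  lia

/-- A list of indices gives an aligned edge. -/
lemma isAlignedEdge_of_list {φ : ℕ → ℤ} {l : List ℕ} {h k : ℕ} {l' l'' : List ℕ}
    (hh : l = h :: l') (hk : l = l'' ++ [k]) (hl : 2 ≤ l.length) (hnd : l.Nodup)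
    (hφ : ∀ i ∈ l, ∀ j ∈ l, φ i = φ j → i = j) :
    IsAlignedEdge {q | ∃ r ∈ listArcs l, q = (φ r.1, φ r.2)} (φ '' {i | i ∈ l}) (φ h) (φ k) := by
  have hget : ∀ i (hi : i < l.length), l.getD i 0 = l[i] := fun i hi => by
    rw [List.getD_eq_getElem?_getD, List.getElem?_eq_getElem hi, Option.getD_some]
  refine ⟨l.length, fun j => φ (l.getD (j - 1) 0), hl, ?_, ?_, ?_, ?_, ?_⟩
  · rintro i ⟨hi, hi'⟩ j ⟨hj, hj'⟩ hij
    simp only at hij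
    rw [hget _ (by lia), hget _ (by lia)] at hij
    have := hφ _ (List.getElem_mem _) _ (List.getElem_mem _) hij
    rw [hnd.getElem_inj_iff] at this
    lia
  · ext x
    constructor
    · rintro ⟨j, ⟨hj, hj'⟩, rfl⟩
      simp only
      rw [hget _ (by lia)]
      exact ⟨_, List.getElem_mem _, rfl⟩
    · rintro ⟨i, hi, rfl⟩
      obtain ⟨j, hj, rfl⟩ := List.mem_iff_getElem.1 hi
      refine ⟨j + 1, ⟨by lia, hj⟩, ?_⟩
      simp only [Nat.add_sub_cancel]
      rw [hget _ hj]
  · ext q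
    constructor
    · rintro ⟨r, hr, rfl⟩
      obtain ⟨i, hi, rfl⟩ := mem_listArcs_iff_getElem.1 hr
      refine ⟨i + 1, by lia, hi, ?_⟩
      simp only [Nat.add_sub_cancel]
      rw [hget i (by lia), hget (i + 1) hi]
    · rintro ⟨j, hj, hj', rfl⟩
      obtain ⟨i, rfl⟩ : ∃ i, j = i + 1 := ⟨j - 1, by lia⟩
      refine ⟨(l[i], l[i + 1]), mem_listArcs_iff_getElem.2 ⟨i, hj', rfl⟩, ?_⟩
      simp only [Nat.add_sub_cancel]
      rw [hget i (by lia), hget (i + 1) hj']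
  · subst hh
    rfl
  · subst hk
    simp

/-! ### The arcs of the straightened edge -/

section Final

variable {n : ℕ} {P : Side → Set ℤ} {M : Side → Set (ℤ × ℤ)} {σ : Side → Equiv.Perm ℤ}
  {E : Set ℤ} {a : ℤ} {e : ℕ} {sg : ℕ → ℤ}

lemma IsEnumeration.mem_S_succ (N : IsEnumeration σ E a e) {i : ℕ} (hi : 1 ≤ i) (hi' : i < e) :
    ((phi σ a i, phi σ a (i + 1)) ∈ S σ ↔ Forward σ a i) ∧
      ((phi σ a (i + 1), phi σ a i) ∈ S σ ↔ ¬ Forward σ a i) := by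
  rw [N.mem_S hi hi'.le, N.mem_S' hi hi'.le]
  have h : 1 < i → phi σ a (i + 1) ≠ phi σ a (i - 1) := fun h h' => by
    rw [N.phi_inj (by lia) (by lia) (by lia) (by lia)] at h'
    lia
  constructor
  · exact ⟨fun h' => h'.elim (fun h' => h'.2.1) fun h' => absurd h'.2.2 (h h'.1),
      fun h' => .inl ⟨hi', h', rfl⟩⟩
  · exact ⟨fun h' => h'.elim (fun h' => h'.2.1) fun h' => absurd h'.2.2 (h h'.1),
      fun h' => .inl ⟨hi', h', rfl⟩⟩

/-- Transfers the straightening to indices. At turning points the signature is `±1`, so `sg t = -1`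
alone can play the role of `neg t`. -/
lemma IsEnumeration.mem_straightenedArcs (N : IsEnumeration σ E a e)
    (hsg : ∀ t, Turn e (Forward σ a) t → sg t = 1 ∨ sg t = -1) (q : ℤ × ℤ) :
    q ∈ straightenedArcs σ a e sg ↔ ∃ r : ℕ × ℕ,
      (r ∈ keptArcs e (Forward σ a) (fun t => sg t = -1) e ∨
        ∃ t, Turn e (Forward σ a) t ∧ t < e ∧ IsExternal e (Forward σ a) (fun t => sg t = -1) t r) ∧
      q = (phi σ a r.1, phi σ a r.2) := by
  have hT : IsInternalTurning σ a e = Turn e (Forward σ a) :=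
    funext fun t => propext (N.isInternalTurning_iff t)
  have hSrc : IsSource σ a e = Src e (Forward σ a) := funext fun t => propext (N.isSource_iff t)
  have hSnk : IsSink σ a e = Snk e (Forward σ a) := funext fun t => propext (N.isSink_iff t)
  have hpos : ∀ t, Turn e (Forward σ a) t → (sg t = 1 ↔ ¬ sg t = -1) := fun t ht => by
    have := hsg t ht
    lia
  have hdel : ∀ i, IsMarkedValue σ a e sg i ↔
      Deleted e (Forward σ a) (fun t => sg t = -1) e i := by
    intro i
    rw [IsMarkedValue, Deleted, hT]
    refine exists_congr fun t => and_congr_right fun ht => ?_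
    rw [hpos t ht]
    exact (and_iff_right ht.2.1).symm
  have hunmarked : q ∈ unmarkedArcs σ a e sg ↔ ∃ r : ℕ × ℕ,
      r ∈ keptArcs e (Forward σ a) (fun t => sg t = -1) e ∧ q = (phi σ a r.1, phi σ a r.2) := by
    constructor
    · rintro ⟨hS, i, h₁, h₂, h₃, rfl | rfl⟩
      · exact ⟨_, ⟨i, h₁, h₂, fun h => h₃ ((hdel i).2 h),
          .inl ⟨(N.mem_S_succ h₁ h₂).1.1 hS, rfl⟩⟩, rfl⟩
      · exact ⟨_, ⟨i, h₁, h₂, fun h => h₃ ((hdel i).2 h),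
          .inr ⟨(N.mem_S_succ h₁ h₂).2.1 hS, rfl⟩⟩, rfl⟩
    · rintro ⟨r, ⟨i, h₁, h₂, h₃, ⟨h₄, rfl⟩ | ⟨h₄, rfl⟩⟩, rfl⟩
      · exact ⟨(N.mem_S_succ h₁ h₂).1.2 h₄, i, h₁, h₂, fun h => h₃ ((hdel i).1 h), .inl rfl⟩
      · exact ⟨(N.mem_S_succ h₁ h₂).2.2 h₄, i, h₁, h₂, fun h => h₃ ((hdel i).1 h), .inr rfl⟩
  have hcross : ∀ same opp t s, Turn e (Forward σ a) t → (Crosses σ a e sg same opp t s ↔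
      IndexCross e (Forward σ a) (fun t => sg t = -1) same opp t s) := by
    intro same opp t s ht
    rw [Crosses, IndexCross, hpos t ht, hT]
    rfl
  have hother : ∀ t, Turn e (Forward σ a) t → ∀ z,
      ((¬ sg t = -1 ∧ z + 1 = t) ∨ (sg t = -1 ∧ z = t + 1)) ↔ z = otherEnd sg t := by
    intro t ht z
    have h1 := ht.1
    have := hsg t ht
    rw [otherEnd]
    split_ifs <;> lia
  have hexternal : q ∈ externalArcs σ a e sg ↔ ∃ r : ℕ × ℕ, (∃ t, Turn e (Forward σ a) t ∧ t < e ∧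
      IsExternal e (Forward σ a) (fun t => sg t = -1) t r) ∧ q = (phi σ a r.1, phi σ a r.2) := by
    simp only [externalArcs, hT, hSrc, hSnk, Set.mem_ofPred_eq]
    constructor
    · rintro ⟨t, s, ht, ⟨h₁, h₂, rfl⟩ | ⟨h₁, h₂, rfl⟩⟩
      · exact ⟨(s, otherEnd sg t), ⟨t, ht, ht.2.1, s, _, (hother t ht _).2 rfl,
          .inl ⟨h₁, (hcross _ _ _ _ ht).1 h₂, rfl⟩⟩, rfl⟩
      · exact ⟨(otherEnd sg t, s), ⟨t, ht, ht.2.1, s, _, (hother t ht _).2 rfl,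
          .inr ⟨h₁, (hcross _ _ _ _ ht).1 h₂, rfl⟩⟩, rfl⟩
    · rintro ⟨r, ⟨t, ht, -, s, z, hz, ⟨h₁, h₂, rfl⟩ | ⟨h₁, h₂, rfl⟩⟩, rfl⟩
      · rw [hother t ht] at hz
        exact ⟨t, s, ht, .inl ⟨h₁, (hcross _ _ _ _ ht).2 h₂, by rw [hz]⟩⟩
      · rw [hother t ht] at hz
        exact ⟨t, s, ht, .inr ⟨h₁, (hcross _ _ _ _ ht).2 h₂, by rw [hz]⟩⟩
  rw [straightenedArcs, Set.mem_union, hunmarked, hexternal, ← exists_or]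
  exact exists_congr fun r => or_and_right.symm

/-- The straightened edge is an aligned edge from a source to a sink. -/
lemma IsEnumeration.exists_isAlignedEdge (N : IsEnumeration σ E a e)
    (hsg : ∀ t, Turn e (Forward σ a) t → sg t = 1 ∨ sg t = -1)
    (hcol : ∀ t, Turn e (Forward σ a) t → Turn e (Forward σ a) (t + 1) → sg t ≠ -1) :
    ∃ h k, Src e (Forward σ a) h ∧ Snk e (Forward σ a) k ∧
      IsAlignedEdge (straightenedArcs σ a e sg) E (phi σ a h) (phi σ a k) := by
  have he := N.one_lt
  obtain ⟨l, hl⟩ := exists_isStraightening (neg := fun t => sg t = -1) he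
    (fun x h₁ h₂ h₃ => absurd h₃ (hcol x h₁ h₂)) e he le_rfl (.inl rfl)
  obtain ⟨h, l', hh, hh'⟩ := hl.head
  obtain ⟨k, l'', hk, hk'⟩ := hl.last
  refine ⟨h, k, hh'.1.1, hk'.1.1, ?_⟩
  have hne : h ≠ k := fun h' => not_src_of_snk he (h' ▸ hk'.1.1) hh'.1.1
  have hlen : 2 ≤ l.length := by
    subst hh
    cases l' with
    | nil =>
      cases l'' with
      | nil => exact absurd (by simpa using hk) hne
      | cons b l'' => simp at hk
    | cons b l' => simp
  have key := isAlignedEdge_of_list (φ := phi σ a) hh hk hlen hl.nodup fun i hi j hj hij => by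
    rw [hl.mem] at hi hj
    exact (N.phi_inj hi.1 hi.2 hj.1 hj.2).1 hij
  convert key using 1
  · ext q
    rw [N.mem_straightenedArcs hsg]
    exact exists_congr fun r => and_congr_left fun _ => (hl.arcs r).symm
  · rw [← N.image]
    congr 1
    ext i
    exact (hl.mem i).symm

/-! ### Positions of sources and sinks -/

/-- Points outside `[1, n]` are fixed by both involutions and form trivial orbits. -/
lemma subset_Icc_of_isEdge (L : ∀ s, IsLayer n (P s) (M s) (σ s))
    (hE : IsEdge (σ .above) (σ .below) E) (hnt : E.Nontrivial) : E ⊆ Set.Icc (1 : ℤ) n := by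
  obtain ⟨x, hx, -⟩ := hE
  have hinv : ∀ s, Function.Involutive (σ s) := fun s => (L s).isModified.involutive
  by_cases h1 : x ∈ Set.Icc (1 : ℤ) n
  · rw [hx]
    have hst : ∀ s, ∀ y ∈ Set.Icc (1 : ℤ) n, σ s y ∈ Set.Icc (1 : ℤ) n := by
      intro s y hy
      obtain ⟨l, r, hc, h₁, h₂⟩ := exists_isComponent (L s).subset hy.1 hy.2
      have := (L s).apply_mem hc h₁ h₂
      have := hc.1
      have := hc.2.2.1
      exact ⟨by lia, by lia⟩
    exact orbit_subset (hinv _) (hinv _) (hst _) (hst _) h1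
  · exfalso
    have hfix : ∀ s, ∀ y ∈ ({x} : Set ℤ), σ s y ∈ ({x} : Set ℤ) := by
      rintro s _ rfl
      exact (L s).isModified.outside _ h1
    have := orbit_subset (hinv .above) (hinv .below) (hfix _) (hfix _) rfl
    rw [← hx] at this
    exact hnt.not_subsingleton (Set.subsingleton_singleton.anti this)

lemma rRel_of_mem_S (L : ∀ s, IsLayer n (P s) (M s) (σ s)) {x y : ℤ} (hx : x ∈ Set.Icc (1 : ℤ) n)
    (h : (x, y) ∈ S σ) : RRel P x y := by
  rcases h with ⟨h, h'⟩ | ⟨h, h'⟩ <;> simp only at h h' <;> subst h'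
  · obtain ⟨l, r, hc, h₁, h₂⟩ := exists_isComponent (L .above).subset hx.1 hx.2
    exact .inl ⟨h, hc.linked h₁ ((L _).apply_mem hc h₁ h₂).2⟩
  · obtain ⟨l, r, hc, h₁, h₂⟩ := exists_isComponent (L .below).subset hx.1 hx.2
    exact .inr ⟨h, hc.linked ((L _).apply_mem hc h₁ h₂).1 h₂⟩

lemma rRel_of_isAlignedEdge (L : ∀ s, IsLayer n (P s) (M s) (σ s)) (hsub : E ⊆ Set.Icc (1 : ℤ) n)
    {A : Set (ℤ × ℤ)} (hA : A ⊆ S σ) {x y : ℤ} (h : IsAlignedEdge A E x y) : RRel P x y := by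
  obtain ⟨p, ψ, hp, hinj, himg, hArcs, rfl, rfl⟩ := h
  have hstep : ∀ j, 1 ≤ j → j < p → RRel P (ψ j) (ψ (j + 1)) := fun j h₁ h₂ =>
    rRel_of_mem_S L (hsub (himg ▸ ⟨j, ⟨h₁, h₂.le⟩, rfl⟩)) (hA (hArcs ▸ ⟨j, h₁, h₂, rfl⟩))
  have : ∀ j, 2 ≤ j → j ≤ p → RRel P (ψ 1) (ψ j) := by
    intro j hj
    induction j, hj using Nat.le_induction with
    | base => exact fun h => hstep 1 le_rfl h
    | succ j hj ih =>
      intro h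
      refine (ih (by lia)).trans (hstep j (by lia) h) fun heq => ?_
      have := hinj ⟨le_rfl, by lia⟩ ⟨by lia, h⟩ heq
      lia
  exact this p hp le_rfl

section Positions

variable {l r l' r' x : ℤ}

/-- At a source `σ⁺` does not move `x` left and `σ⁻` does not move it right. If one of them fixes
`x`, the weak comparison of centres applies; if both move it, the strict one. -/
lemma centre_le_of_source (hM : IsMarking n P M) (L : ∀ s, IsLayer n (P s) (M s) (σ s))
    (hc : IsComponent n (P .above) l r) (hc' : IsComponent n (P .below) l' r')
    (h₁ : l ≤ x) (h₂ : x ≤ r) (h₃ : l' ≤ x) (h₄ : x ≤ r') (hsrc : ∀ y, (y, x) ∉ S σ)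
    (hne : ¬ (σ .above x = x ∧ σ .below x = x)) :
    l' + r' ≤ l + r ∧ (l' + r' = l + r → ∃ s, σ s x = x) := by
  have ha : x ≤ σ .above x := by
    by_contra! h
    exact hsrc _ (.inl ⟨h, (L _).isModified.involutive x⟩)
  have hb : σ .below x ≤ x := by
    by_contra! h
    exact hsrc _ (.inr ⟨h, (L _).isModified.involutive x⟩)
  rcases eq_or_lt_of_le ha with ha | ha <;> rcases eq_or_lt_of_le hb with hb | hb
  · exact absurd ⟨ha.symm, hb⟩ hne
  · exact ⟨centre_le_of_fixed_of_gt hM L (by simp) hc hc' h₁ h₂ h₃ h₄ ha.symm hb,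
      fun _ => ⟨_, ha.symm⟩⟩
  · exact ⟨centre_le_of_fixed_of_lt hM L (by simp) hc' hc h₃ h₄ h₁ h₂ hb ha, fun _ => ⟨_, hb⟩⟩
  · have := centre_lt_of_lt_of_gt hM L (by simp) hc' hc h₃ h₄ h₁ h₂ hb ha
    exact ⟨this.le, fun h => absurd h this.ne⟩

lemma centre_le_of_sink (hM : IsMarking n P M) (L : ∀ s, IsLayer n (P s) (M s) (σ s))
    (hc : IsComponent n (P .above) l r) (hc' : IsComponent n (P .below) l' r')
    (h₁ : l ≤ x) (h₂ : x ≤ r) (h₃ : l' ≤ x) (h₄ : x ≤ r') (hsnk : ∀ y, (x, y) ∉ S σ)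
    (hne : ¬ (σ .above x = x ∧ σ .below x = x)) :
    l + r ≤ l' + r' ∧ (l + r = l' + r' → ∃ s, σ s x = x) := by
  have ha : σ .above x ≤ x := by
    by_contra! h
    exact hsnk _ (.inl ⟨h, rfl⟩)
  have hb : x ≤ σ .below x := by
    by_contra! h
    exact hsnk _ (.inr ⟨h, rfl⟩)
  rcases eq_or_lt_of_le ha with ha | ha <;> rcases eq_or_lt_of_le hb with hb | hb
  · exact absurd ⟨ha, hb.symm⟩ hne
  · exact ⟨centre_le_of_fixed_of_lt hM L (by simp) hc hc' h₁ h₂ h₃ h₄ ha hb, fun _ => ⟨_, ha⟩⟩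
  · exact ⟨centre_le_of_fixed_of_gt hM L (by simp) hc' hc h₃ h₄ h₁ h₂ hb.symm ha,
      fun _ => ⟨_, hb.symm⟩⟩
  · have := centre_lt_of_lt_of_gt hM L (by simp) hc hc' h₁ h₂ h₃ h₄ ha hb
    exact ⟨this.le, fun h => absurd h this.ne⟩

end Positions

lemma IsComponent.eq_or_lt {n : ℕ} {Q : Set ℤ} {l r l' r' x y : ℤ} (hc : IsComponent n Q l r)
    (hc' : IsComponent n Q l' r') (h₁ : l ≤ x) (h₂ : y ≤ r') (hxy : x < y) :
    (l = l' ∧ r = r') ∨ l + r < l' + r' := by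
  by_cases h : l' ≤ r
  · left
    rcases le_total l l' with h' | h'
    · exact hc.eq_of_mem hc' h' h le_rfl hc'.2.1
    · exact hc.eq_of_mem hc' (x := l) le_rfl hc.2.1 h' (by lia)
  · right
    have := hc.2.1
    have := hc'.2.1
    lia

/-- The two end-points of an edge are not in the same components if these are concentric. -/
lemma IsEnumeration.false_of_concentric (N : IsEnumeration σ E a e) (hM : IsMarking n P M)
    (L : ∀ s, IsLayer n (P s) (M s) (σ s))
    (hP : P .above ∪ P .below = Set.Icc (1 : ℤ) (n - 1))
    (hP' : P .above ∩ P .below ≠ Set.Icc (1 : ℤ) (n - 1)) (hsub : E ⊆ Set.Icc (1 : ℤ) n)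
    {cl cr : Side → ℤ} {c : ℤ} (hcomp : ∀ s, IsComponent n (P s) (cl s) (cr s))
    (hc : ∀ s, cl s + cr s = c) {x y : ℤ} (hx : x ∈ E) (hy : y ∈ E) (hxy : x ≠ y)
    (hx' : ∃ s, σ s x = x) (hy' : ∃ s, σ s y = y) (hxc : ∀ s, cl s ≤ x ∧ x ≤ cr s)
    (hyc : ∀ s, cl s ≤ y ∧ y ≤ cr s) : False := by
  classical
  have he := N.one_lt
  have hends : ∀ z ∈ E, (∃ s, σ s z = z) → z = phi σ a 1 ∨ z = phi σ a e := by
    rintro z hz ⟨s, hs⟩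
    obtain ⟨i, h₁, h₂, rfl⟩ := N.exists_index hz
    rcases (N.fixed_iff h₁ h₂).1 hs with ⟨rfl, -⟩ | ⟨rfl, -⟩
    exacts [.inl rfl, .inr rfl]
  have hbnd : ∀ z ∈ E, (∃ s, σ s z = z) → ∀ s, cl s ≤ z ∧ z ≤ cr s := by
    intro z hz hz' s
    have : z = x ∨ z = y := by
      rcases hends x hx hx' with h | h <;> rcases hends y hy hy' with h' | h' <;>
        rcases hends z hz hz' with h'' | h'' <;> lia
    rcases this with rfl | rfl
    exacts [hxc s, hyc s]
  have h1E : phi σ a 1 ∈ E := N.phi_mem le_rfl he.le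
  have heE : phi σ a e ∈ E := N.phi_mem he.le le_rfl
  have h1e : phi σ a 1 ≠ phi σ a e := fun h => by
    rw [N.phi_inj le_rfl he.le he.le le_rfl] at h
    lia
  have h1fix : σ (arcSide σ a 0) (phi σ a 1) = phi σ a 1 :=
    (N.fixed_iff le_rfl he.le).2 (.inl ⟨rfl, rfl⟩)
  have hefix : σ (arcSide σ a e) (phi σ a e) = phi σ a e :=
    (N.fixed_iff he.le le_rfl).2 (.inr ⟨rfl, rfl⟩)
  have hfix : ∀ s z, (z ∈ E ∧ σ s z = z) ↔
      (z = phi σ a 1 ∧ s = arcSide σ a 0) ∨ (z = phi σ a e ∧ s = arcSide σ a e) := by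
    intro s z
    constructor
    · rintro ⟨hz, hs⟩
      obtain ⟨i, h₁, h₂, rfl⟩ := N.exists_index hz
      rcases (N.fixed_iff h₁ h₂).1 hs with ⟨rfl, h⟩ | ⟨rfl, h⟩
      exacts [.inl ⟨rfl, h⟩, .inr ⟨rfl, h⟩]
    · rintro (⟨rfl, rfl⟩ | ⟨rfl, rfl⟩)
      exacts [⟨h1E, h1fix⟩, ⟨heE, hefix⟩]
  -- If the end-points are fixed on the same side, each involution has an even number of fixed
  -- points in `E`; otherwise each has exactly one.
  have C : IsConcentric n P M σ E cl cr c (if arcSide σ a 0 = arcSide σ a e then 0 else 1) := by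
    refine ⟨L, hM, hsub, fun s x hx => N.apply_mem s hx, hcomp, hc,
      fun s z hz hz' => hbnd z hz ⟨s, hz'⟩ s, ?_, ?_⟩
    · intro s Y hY
      have hsum : ∀ z ∈ Y, (if z ∈ E ∧ σ s z = z then (1 : ZMod 2) else 0) =
          (if phi σ a 1 = z then (if s = arcSide σ a 0 then 1 else 0) else 0) +
            (if phi σ a e = z then (if s = arcSide σ a e then 1 else 0) else 0) := by
        intro z _
        simp only [hfix]
        rcases eq_or_ne (phi σ a 1) z with rfl | h
        · simp [h1e, h1e.symm]
        · rcases eq_or_ne (phi σ a e) z with rfl | h'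
          · simp [h1e, h1e.symm]
          · simp [h, h', h.symm, h'.symm]
      have h1Y : s = arcSide σ a 0 → phi σ a 1 ∈ Y := fun h => hY _ h1E (h ▸ h1fix)
      have heY : s = arcSide σ a e → phi σ a e ∈ Y := fun h => hY _ heE (h ▸ hefix)
      have hfin : ∑ z ∈ Y, (if z ∈ E ∧ σ s z = z then (1 : ZMod 2) else 0) =
          (if s = arcSide σ a 0 then 1 else 0) + (if s = arcSide σ a e then 1 else 0) := by
        rw [Finset.sum_congr rfl hsum, Finset.sum_add_distrib, Finset.sum_ite_eq,
          Finset.sum_ite_eq]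
        congr 1
        · by_cases h : s = arcSide σ a 0
          · rw [if_pos (h1Y h)]
          · simp [h]
        · by_cases h : s = arcSide σ a e
          · rw [if_pos (heY h)]
          · simp [h]
      have htwo : (1 : ZMod 2) + 1 = 0 := by decide
      refine Eq.trans ?_ (hfin.trans ?_)
      · exact Finset.sum_congr rfl fun z _ => by congr
      · cases s <;> cases arcSide σ a 0 <;> cases arcSide σ a e <;> simp [htwo]
    -- If each side fixes one end-point, a half-integer centre would carry a marked trivial arc on
    -- both sides.
    · intro hne
      by_contra hodd
      rw [Int.not_even_iff_odd] at hodd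
      obtain ⟨k, hk⟩ := hodd
      have hmark : ∀ s z, z ∈ E → σ s z = z → (k, k) ∈ M s := by
        intro s z hz hz'
        have hb := hbnd z hz ⟨s, hz'⟩ s
        have hcs := hc s
        have := (L s).marked_of_fixed (hcomp s) hb.1 hb.2 (by lia) hz' (i := k) (by lia) (by lia)
        rw [IsMarkedArc] at this
        convert this using 2; lia
      have := (hM.unique (hmark _ _ h1E h1fix) (hmark _ _ heE hefix) (.refl _)).1
      exact hne (if_pos this)
  exact C.false hP hP' ⟨x, hx⟩

/-- A sink does not precede a source with respect to `R`. -/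
lemma IsEnumeration.not_rRel (N : IsEnumeration σ E a e) (hM : IsMarking n P M)
    (L : ∀ s, IsLayer n (P s) (M s) (σ s))
    (hP : P .above ∪ P .below = Set.Icc (1 : ℤ) (n - 1))
    (hP' : P .above ∩ P .below ≠ Set.Icc (1 : ℤ) (n - 1)) (hsub : E ⊆ Set.Icc (1 : ℤ) n)
    {x y : ℤ} (hx : x ∈ E) (hy : y ∈ E) (hxs : ∀ z, (z, x) ∉ S σ) (hys : ∀ z, (y, z) ∉ S σ) :
    ¬ RRel P y x := by
  intro hR
  have hxy : x ≠ y := by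
    rintro rfl
    rcases hR with h | h <;> lia
  have hmove : ∀ z ∈ E, ¬ (σ .above z = z ∧ σ .below z = z) := by
    rintro z hz ⟨h₁, h₂⟩
    have he := N.one_lt
    obtain ⟨i, hi, hi', rfl⟩ := N.exists_index hz
    have hall : ∀ s, σ s (phi σ a i) = phi σ a i := fun s => by cases s <;> assumption
    rcases eq_or_lt_of_le hi' with rfl | hlt
    · have h := N.apply_phi_succ (i - 1)
      rw [Nat.sub_add_cancel hi, hall, N.phi_inj hi le_rfl (by lia) (by lia)] at h
      lia
    · exact N.phi_ne_succ hi hlt ((hall _).symm.trans (N.phi_succ i).symm)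
  obtain ⟨l₁, r₁, hc₁, h₁, h₁'⟩ := exists_isComponent (L .above).subset (hsub hx).1 (hsub hx).2
  obtain ⟨l₂, r₂, hc₂, h₂, h₂'⟩ := exists_isComponent (L .below).subset (hsub hx).1 (hsub hx).2
  obtain ⟨l₃, r₃, hc₃, h₃, h₃'⟩ := exists_isComponent (L .above).subset (hsub hy).1 (hsub hy).2
  obtain ⟨l₄, r₄, hc₄, h₄, h₄'⟩ := exists_isComponent (L .below).subset (hsub hy).1 (hsub hy).2
  have hX := centre_le_of_source hM L hc₁ hc₂ h₁ h₁' h₂ h₂' hxs (hmove x hx)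
  have hY := centre_le_of_sink hM L hc₃ hc₄ h₃ h₃' h₄ h₄' hys (hmove y hy)
  -- One side has a shared interval; on the other, the order of `x` and `y` orders the centres.
  -- Together with `hX` and `hY` this is a cycle of weak inequalities, so a strict step is
  -- impossible.
  have hkey : (l₁ = l₃ ∧ r₁ = r₃) ∧ (l₂ = l₄ ∧ r₂ = r₄) ∧ l₁ + r₁ = l₂ + r₂ := by
    rcases hR with ⟨hlt, hlink⟩ | ⟨hlt, hlink⟩
    · have hsame := hc₁.eq_of_mem hc₃ h₁ h₁' (by lia) (hc₃.le_of_linked h₃' hlink)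
      rcases hc₄.eq_or_lt hc₂ h₄ h₂' hlt with h | h
      · exact ⟨hsame, ⟨h.1.symm, h.2.symm⟩, by lia⟩
      · lia
    · have hsame := hc₂.eq_of_mem hc₄ h₂ h₂' (hc₄.ge_of_linked h₄ hlink) (by lia)
      rcases hc₁.eq_or_lt hc₃ h₁ h₃' hlt with h | h
      · exact ⟨h, hsame, by lia⟩
      · lia
  obtain ⟨⟨rfl, rfl⟩, ⟨rfl, rfl⟩, hsum⟩ := hkey
  refine N.false_of_concentric hM L hP hP' hsub (cl := fun s => match s with
    | .above => l₁ | .below => l₂) (cr := fun s => match s with | .above => r₁ | .below => r₂)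
    (c := l₁ + r₁) ?_ ?_ hx hy hxy (hX.2 hsum.symm) (hY.2 hsum) ?_ ?_
  · intro s; cases s <;> assumption
  · intro s; cases s
    exacts [rfl, hsum.symm]
  · intro s; cases s
    exacts [⟨h₁, h₁'⟩, ⟨h₂, h₂'⟩]
  · intro s; cases s
    exacts [⟨h₃, h₃'⟩, ⟨h₄, h₄'⟩]

/-- Of two adjacent internal turning points the first does not have negative signature, since the
arc joining them is nil. -/
lemma IsEnumeration.isNil_of_turn (N : IsEnumeration σ E a e)
    (L : ∀ s, IsLayer n (P s) (M s) (σ s)) (hsub : E ⊆ Set.Icc (1 : ℤ) n) {t : ℕ}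
    (ht : Turn e (Forward σ a) t) (ht' : Turn e (Forward σ a) (t + 1)) :
    IsNil n P (beta σ a t) := by
  have h1 := ht.1
  have h2 := ht'.2.1
  have hy := hsub (N.phi_mem h1.le ht.2.1.le)
  have hz := hsub (N.phi_mem (i := t + 1) (by lia) h2.le)
  have hne := N.phi_ne_succ h1.le ht.2.1
  rw [beta, isNil_root (fun s => (L s).subset) hy hz hne]
  rintro ⟨hR, hR'⟩
  obtain ⟨k, rfl⟩ : ∃ k, t = k + 1 := ⟨t - 1, by lia⟩
  have hp := (N.isInternalTurning_iff _).2 ht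
  have hp' := (N.isInternalTurning_iff _).2 ht'
  rw [IsInternalTurning, Nat.add_sub_cancel, mul_neg_iff] at hp hp'
  -- The arcs before and after the middle one lie on the same side. If the middle one is not nil,
  -- its ends share an interval there. The walk is monotone through all four points, so, in its
  -- direction, the arc before puts the centre no later than `φ(t)` and the arc after puts it no
  -- earlier than `φ(t + 1)`.
  have hside : arcSide σ a (k + 1 + 1) = arcSide σ a k := Side.flip_flip _
  have hy' : σ (arcSide σ a k) (phi σ a (k + 1)) = phi σ a k := N.apply_phi_succ k
  have hz' : σ (arcSide σ a k) (phi σ a (k + 1 + 1)) = phi σ a (k + 1 + 1 + 1) := by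
    rw [N.phi_succ (k + 1 + 1), hside]
  obtain ⟨l, r, hc, h₁, h₂⟩ := exists_isComponent (L (arcSide σ a k)).subset hy.1 hy.2
  have hlink : ∀ s, (phi σ a (k + 1) < phi σ a (k + 1 + 1) →
      Linked (P s) (phi σ a (k + 1)) (phi σ a (k + 1 + 1))) ∧
      (phi σ a (k + 1 + 1) < phi σ a (k + 1) →
        Linked (P s) (phi σ a (k + 1 + 1)) (phi σ a (k + 1))) := by
    intro s
    rcases hR with ⟨h₃, h₄⟩ | ⟨h₃, h₄⟩ <;> rcases hR' with ⟨h₅, h₆⟩ | ⟨h₅, h₆⟩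
    · lia
    · cases s
      exacts [⟨fun _ => h₄, fun h => by lia⟩, ⟨fun _ => h₆, fun h => by lia⟩]
    · cases s
      exacts [⟨fun h => by lia, fun _ => h₆⟩, ⟨fun h => by lia, fun _ => h₄⟩]
    · lia
  rcases lt_or_gt_of_ne hne with hlt | hlt
  · have hzr := hc.le_of_linked h₂ ((hlink _).1 hlt)
    have e₁ := (L _).crosses_centre' hc h₁ h₂ (by rw [hy']; lia)
    have e₂ := (L _).crosses_centre hc (h₁.trans hlt.le) hzr (by rw [hz']; lia)
    lia
  · have hzl := hc.ge_of_linked h₁ ((hlink _).2 hlt)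
    have e₁ := (L _).crosses_centre hc h₁ h₂ (by rw [hy']; lia)
    have e₂ := (L _).crosses_centre' hc hzl (hlt.le.trans h₂) (by rw [hz']; lia)
    lia

end Final

end Biparabolic

theorem corollary8p4
    -- the double partition, given by the pair of sets of simple roots, and the standing assumptions
    (n : ℕ) (hn : 1 < n) (P : Biparabolic.Side → Set ℤ)
    (hP : P .above ∪ P .below = Set.Icc (1 : ℤ) (n - 1))
    (hP' : P .above ∩ P .below ≠ Set.Icc (1 : ℤ) (n - 1))
    -- the markings and the modified involutions
    (M : Biparabolic.Side → Set (ℤ × ℤ)) (hM : Biparabolic.IsMarking n P M)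
    (σ : Biparabolic.Side → Equiv.Perm ℤ)
    (hσ : ∀ s, Biparabolic.IsModifiedInvolution n (P s) (M s) (σ s))
    -- a non-trivial edge with a choice of its starting point
    (E : Set ℤ) (hE : Biparabolic.IsEdge (σ .above) (σ .below) E) (hE' : E.Nontrivial)
    (a : ℤ) (ha : Biparabolic.IsEdgeEnd σ E a)
    -- a signature on its internal turning points
    (sg : ℕ → ℤ) (hsg : Biparabolic.IsSignature n P σ a E.ncard sg) :
    (∃ x y, Biparabolic.IsAlignedEdge
      (Biparabolic.straightenedArcs σ a E.ncard sg) E x y) ∧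
    ∀ x y, Biparabolic.IsAlignedEdge (Biparabolic.straightenedArcs σ a E.ncard sg) E x y →
      Biparabolic.root x y ∈ -Biparabolic.K n P ∧
      (Biparabolic.edgeArcs σ E = Biparabolic.straightenedArcs σ a E.ncard sg →
        Biparabolic.root x y ∈ -Biparabolic.K n P ∩ Biparabolic.R n P ∧
        -Biparabolic.K n P ∩ Biparabolic.R n P = -Biparabolic.RStar n P) := by
  open Biparabolic in
  have hQ : ∀ s, P s ⊆ Set.Icc (1 : ℤ) (n - 1) := fun s => by
    rw [← hP]
    cases s
    exacts [Set.subset_union_left, Set.subset_union_right]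
  have L : ∀ s, IsLayer n (P s) (M s) (σ s) := fun s => ⟨hQ s, hM.isHalfArc s, hσ s⟩
  have hsub := subset_Icc_of_isEdge L hE hE'
  have N := isEnumeration (fun s => (hσ s).involutive) ((Set.finite_Icc _ _).subset hsub) hE hE' ha
  have hsg' := fun t ht => hsg t ((N.isInternalTurning_iff t).2 ht)
  obtain ⟨h, k, hh, hk, hal⟩ := N.exists_isAlignedEdge (fun t ht => (hsg' t ht).1) fun t ht ht' => by
    -- Whether or not `β_{t-1}` is nil, a nil `β_t` forces signature `1`.
    have hnil := N.isNil_of_turn L hsub ht ht'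
    by_cases h : IsNil n P (beta σ a (t - 1))
    · rw [(hsg' t ht).2.1 h hnil]; decide
    · rw [(hsg' t ht).2.2.2 h hnil]; decide
  refine ⟨⟨_, _, hal⟩, fun x y hxy => ?_⟩
  obtain ⟨hne, hx, hy⟩ := hxy.ne
  obtain ⟨rfl, rfl⟩ := hxy.unique hal
  have hK := (root_mem_neg_K hQ (hsub hx) (hsub hy) hne).2 (N.not_rRel hM L hP hP' hsub hx hy
    ((N.isSource_iff h).2 hh).2 ((N.isSink_iff k).2 hk).2)
  refine ⟨hK, fun hEq => ⟨⟨hK, ?_⟩, neg_K_inter_R⟩⟩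
  rw [root_mem_R hQ (hsub hx) (hsub hy) hne]
  exact rRel_of_isAlignedEdge L hsub (hEq ▸ fun q hq => hq.1) hxy
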